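/- **Corollary (dense embedding into an f-algebra).** Let $R$ be a Riesz space, i.e. a real vector space with a compatible lattice order (not assumed Archimedean), and let $1\in R$ be a strong unit: for every $a\in R$ there is $n\in\mathbb N$ with $|a|\le n\cdot 1$. For a Riesz space with unit put $\|a\|=\inf\{q\ge 0 : |a|\le q\cdot 1\}$. Let $\Sigma$ be the locale whose frame of opens is presented by generators $D(a)$, $a\in R$, and the relations $D(a)=\bot$ if $a\le 0$; $D(1)=\top$; $D(a)\wedge D(-a)=\bot$; $D(a+b)\le D(a)\vee D(b)$; $D(a\vee b)=D(a)\vee D(b)$; $D(a)=\bigvee_{s>0}D(a-s\cdot 1)$. Let $\mathrm{Loc}(\Sigma,\mathbb R)$ be the set of locale maps $\Sigma\to\mathbb R$, i.e. of frame homomorphisms from the frame of opens of $\mathbb R$ to that of $\Sigma$, with the operations $+,\cdot,\vee,\wedge$ and scalar multiplication induced by composition with those of $\mathbb R$. Then $\mathrm{Loc}(\Sigma,\mathbb R)$ is an f-algebra (a Riesz space with an associative bilinear multiplication such that $a,b\ge 0$ implies $ab\ge 0$, and $a\wedge b=0$, $c\ge 0$ imply $(ca)\wedge b=(ac)\wedge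 b=0$); the constant function $1$ is its multiplicative identity and a strong unit. Moreover there is a linear map $\hat{\cdot}:R\to\mathrm{Loc}(\Sigma,\mathbb R)$ with $$\hat a^{-1}\big((p,q)\big)=D\big((a-p\cdot 1)\wedge(q\cdot 1-a)\big)\qquad(a\in R,\ p,q\in\mathbb R),$$ and it is a norm-preserving Riesz morphism with dense image: $\widehat{a\vee b}=\hat a\vee\hat b$, $\widehat{a\wedge b}=\hat a\wedge\hat b$, $\hat 1=1$, $\|\hat a\|=\|a\|$ for all $a,b\in R$, and for every $f\in\mathrm{Loc}(\Sigma,\mathbb R)$ and $\varepsilon>0$ there is $a\in R$ with $\|f-\hat a\|<\varepsilon$. -/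

import Mathlib

open TopologicalSpace

/-! ### Riesz spaces with unit and f-algebras

A Riesz space is a real vector space `R` with a compatible lattice order, that is
`[AddCommGroup R] [Lattice R] [IsOrderedAddMonoid R] [Module ℝ R] [PosSMulMono ℝ R]`. -/

/-- `u` is a (strong) unit of `R`: every element is bounded by a natural multiple of `u`. -/
def IsStrongUnit {R : Type*} [AddCommGroup R] [Lattice R] (u : R) : Prop :=
  ∀ a : R, ∃ n : ℕ, |a| ≤ n • u

/-- The norm defined by the unit `u`: `‖a‖ = inf {q ≥ 0 | |a| ≤ q u}`. -/
noncomputable def unitNorm {R : Type*} [AddCommGroup R] [Lattice R] [Module ℝ R] (u a : R) : ℝ :=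
  sInf {q : ℝ | 0 ≤ q ∧ |a| ≤ q • u}

/-- An f-algebra: a Riesz space with an associative bilinear multiplication such that products of
positive elements are positive, and `a ⊓ b = 0`, `0 ≤ c` imply `(c * a) ⊓ b = 0 = (a * c) ⊓ b`. -/
class FAlgebra (A : Type*) extends NonUnitalRing A, Module ℝ A, Lattice A,
    IsOrderedAddMonoid A, PosSMulMono ℝ A, IsScalarTower ℝ A A, SMulCommClass ℝ A A where
  protected mul_nonneg : ∀ a b : A, 0 ≤ a → 0 ≤ b → 0 ≤ a * b
  mul_left_inf_eq_zero : ∀ a b c : A, a ⊓ b = 0 → 0 ≤ c → (c * a) ⊓ b = 0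
  mul_right_inf_eq_zero : ∀ a b c : A, a ⊓ b = 0 → 0 ≤ c → (a * c) ⊓ b = 0

/-! ### Frames presented by generators and relations -/

/-- A set `S` of finite sets of generators, thought of as `⋁_{F ∈ S} ⋀ F`, is saturated for the
relations `rel` if it is closed under passing to larger finite sets (smaller meets) and under the
coverings which the relations generate. Here `rel A C` stands for `⋀ A ≤ ⋁_{B ∈ C} ⋀ B`. -/
structure IsSaturated {G : Type*} (rel : Finset G → Set (Finset G) → Prop)
    (S : Set (Finset G)) : Prop where
  mono : ∀ F ∈ S, ∀ H : Finset G, F ⊆ H → H ∈ S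
  cover : ∀ A C, rel A C → ∀ F : Finset G, A ⊆ F →
    (∀ B ∈ C, ∀ H : Finset G, F ⊆ H → B ⊆ H → H ∈ S) → F ∈ S

/-- The frame with generators `G` and relations `⋀ A ≤ ⋁_{B ∈ C} ⋀ B` for all `A`, `C` with
`rel A C`, realized as the saturated sets ordered by inclusion. -/
def PresentedFrame {G : Type*} (rel : Finset G → Set (Finset G) → Prop) : Type _ :=
  {S : Set (Finset G) // IsSaturated rel S}

namespace PresentedFrame

variable {G : Type*} {rel : Finset G → Set (Finset G) → Prop}

instance : PartialOrder (PresentedFrame rel) :=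
  inferInstanceAs (PartialOrder {S : Set (Finset G) // IsSaturated rel S})

instance : InfSet (PresentedFrame rel) where
  sInf X := ⟨{F | ∀ S ∈ X, F ∈ S.1}, by
    refine ⟨fun F hF H h S hS => S.2.mono F (hF S hS) H h, fun A C hr F hA hC S hS => ?_⟩
    exact S.2.cover A C hr F hA fun B hB H h₁ h₂ => hC B hB H h₁ h₂ S hS⟩

instance : CompleteLattice (PresentedFrame rel) :=
  completeLatticeOfInf _ fun _ =>
    ⟨fun S hS _ hF => hF S hS, fun _ hT _ hF _ hS => hT hS hF⟩

instance : Order.Frame (PresentedFrame rel) :=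
  Order.Frame.ofMinimalAxioms
    { inf_sSup_le_iSup_inf := by
        intro a s
        let t : PresentedFrame rel := ⨆ b ∈ s, a ⊓ b
        let h : PresentedFrame rel :=
          ⟨{F | ∀ H : Finset G, F ⊆ H → H ∈ a.1 → H ∈ t.1}, by
            refine ⟨fun F hF H h K hK => hF K (h.trans hK), fun A C hr F hA hC H hH ha => ?_⟩
            refine t.2.cover A C hr H (hA.trans hH) fun B hB K h₁ h₂ => ?_
            exact hC B hB K (hH.trans h₁) h₂ K (Finset.Subset.refl K) (a.2.mono H ha K h₁)⟩
        have hs : sSup s ≤ h := by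
          refine sSup_le fun b hb F hF H hH ha => ?_
          have hle : a ⊓ b ≤ t := le_iSup₂_of_le b hb le_rfl
          let c : PresentedFrame rel := ⟨a.1 ∩ b.1,
            fun F hF H h => ⟨a.2.mono F hF.1 H h, b.2.mono F hF.2 H h⟩,
            fun A C hr F hA hC => ⟨a.2.cover A C hr F hA fun B hB K h₁ h₂ => (hC B hB K h₁ h₂).1,
              b.2.cover A C hr F hA fun B hB K h₁ h₂ => (hC B hB K h₁ h₂).2⟩⟩
          have hc : c ≤ a ⊓ b := le_inf (fun _ h => h.1) (fun _ h => h.2)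
          exact hle (hc ⟨ha, b.2.mono F hF H hH⟩)
        intro F hF
        have h₁ : a ⊓ sSup s ≤ a := inf_le_left
        have h₂ : a ⊓ sSup s ≤ h := inf_le_right.trans hs
        exact h₂ hF F (Finset.Subset.refl F) (h₁ hF) }

/-- The generators: `of g` is the smallest saturated set that contains `{g}`. -/
def of (g : G) : PresentedFrame rel :=
  sInf {S | {g} ∈ S.1}

end PresentedFrame

/-! ### The spectrum of a Riesz space with unit, as a locale -/

open Classical in
/-- The relations between the generators `D a` (`a ∈ R`) of the spectrum; `u` is the unit. -/
inductive SpectrumRel {R : Type*} [AddCommGroup R] [Lattice R] [Module ℝ R] (u : R) :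
    Finset R → Set (Finset R) → Prop
  /-- `D a = ⊥` if `a ≤ 0` -/
  | nonpos (a : R) (h : a ≤ 0) : SpectrumRel u {a} ∅
  /-- `D u = ⊤` -/
  | unit : SpectrumRel u ∅ {{u}}
  /-- `D a ⊓ D (-a) = ⊥` -/
  | neg (a : R) : SpectrumRel u {a, -a} ∅
  /-- `D (a + b) ≤ D a ⊔ D b` -/
  | add (a b : R) : SpectrumRel u {a + b} {{a}, {b}}
  /-- `D (a ⊔ b) ≤ D a ⊔ D b` -/
  | sup (a b : R) : SpectrumRel u {a ⊔ b} {{a}, {b}}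
  /-- `D a ≤ D (a ⊔ b)` -/
  | left (a b : R) : SpectrumRel u {a} {{a ⊔ b}}
  /-- `D b ≤ D (a ⊔ b)` -/
  | right (a b : R) : SpectrumRel u {b} {{a ⊔ b}}
  /-- `D a ≤ ⨆_{s > 0} D (a - s u)` -/
  | cont (a : R) : SpectrumRel u {a} {B | ∃ s : ℝ, 0 < s ∧ B = {a - s • u}}
  /-- `D (a - s u) ≤ D a` for `s > 0` -/
  | cont' (a : R) (s : ℝ) (hs : 0 < s) : SpectrumRel u {a - s • u} {{a}}

/-- The frame of opens of the spectrum `Σ` of the Riesz space `R` with unit `u`. -/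
abbrev Spectrum {R : Type*} [AddCommGroup R] [Lattice R] [Module ℝ R] (u : R) : Type _ :=
  PresentedFrame (SpectrumRel u)

/-- The basic open `D a` of the spectrum, thought of as `{σ | 0 < σ a}`. -/
def Spectrum.D {R : Type*} [AddCommGroup R] [Lattice R] [Module ℝ R] (u a : R) : Spectrum u :=
  PresentedFrame.of a

/-! ### Continuous real functions on a locale -/

/-- `Loc L` is `Loc(X, ℝ)` for the locale `X` with frame of opens `L`: a continuous map `X → ℝ` is
a frame homomorphism from the opens of `ℝ` to `L`. -/
@[ext]
structure Loc (L : Type*) [Order.Frame L] where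
  /-- the inverse image map -/
  preimage : FrameHom (Opens ℝ) L

namespace Loc

variable {L : Type*} [Order.Frame L]

/-- The composite `c ∘ f` of `f : X → ℝ` with a continuous map `c : ℝ → ℝ`. -/
def map (c : C(ℝ, ℝ)) (f : Loc L) : Loc L :=
  ⟨f.preimage.comp (Opens.comap c)⟩

open Classical in
/-- The constant function with value `r`. -/
noncomputable def const (L : Type*) [Order.Frame L] (r : ℝ) : Loc L where
  preimage :=
    { toFun := fun U => if r ∈ U then ⊤ else ⊥
      map_inf' := by
        intro U V
        by_cases h₁ : r ∈ U <;> by_cases h₂ : r ∈ V <;> simp [h₁, h₂]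
      map_top' := by simp
      map_sSup' := by
        intro s
        by_cases h : ∃ U ∈ s, r ∈ U
        · obtain ⟨U, hU, hr⟩ := h
          rw [if_pos (Opens.mem_sSup.2 ⟨U, hU, hr⟩)]
          have ht : (⊤ : L) ∈ (fun U : Opens ℝ => if r ∈ U then (⊤ : L) else ⊥) '' s :=
            ⟨U, hU, if_pos hr⟩
          exact (top_unique (le_sSup ht)).symm
        · rw [if_neg (fun hr => h (Opens.mem_sSup.1 hr))]
          refine (bot_unique (sSup_le ?_)).symm
          rintro _ ⟨U, hU, rfl⟩
          have hr : r ∉ U := fun hr => h ⟨U, hU, hr⟩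
          simp [hr] }

theorem le_of_local (f : FrameHom (Opens ℝ) L) (V : Opens ℝ) (c : L)
    (h : ∀ x ∈ V, ∃ A : Opens ℝ, x ∈ A ∧ f A ≤ c) : f V ≤ c := by
  have hV : V ≤ sSup {A : Opens ℝ | f A ≤ c} := fun x hx => by
    obtain ⟨A, hA, hc⟩ := h x hx
    exact Opens.mem_sSup.2 ⟨A, hc, hA⟩
  refine (OrderHomClass.mono f hV).trans ?_
  rw [map_sSup]
  refine sSup_le ?_
  rintro _ ⟨A, hA, rfl⟩
  exact hA

/-- Join preservation for `map₂`; it rests on the local compactness of `ℝ`. -/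
theorem tube (m : C(ℝ × ℝ, ℝ)) (f g : FrameHom (Opens ℝ) L) (s : Set (Opens ℝ)) (V W : Opens ℝ)
    (h : ∀ x ∈ V, ∀ y ∈ W, m (x, y) ∈ sSup s) :
    f V ⊓ g W ≤ ⨆ U ∈ s, ⨆ (A : Opens ℝ) (B : Opens ℝ) (_ : ∀ x ∈ A, ∀ y ∈ B, m (x, y) ∈ U),
      f A ⊓ g B := by
  set T : L := ⨆ U ∈ s, ⨆ (A : Opens ℝ) (B : Opens ℝ) (_ : ∀ x ∈ A, ∀ y ∈ B, m (x, y) ∈ U),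
      f A ⊓ g B with hT
  rw [inf_comm, ← le_himp_iff]
  refine le_of_local g W _ fun y hy => ?_
  obtain ⟨r, hr, hrW⟩ := Metric.nhds_basis_closedBall.mem_iff.1 (W.isOpen.mem_nhds hy)
  refine ⟨⟨Metric.ball y r, Metric.isOpen_ball⟩, Metric.mem_ball_self hr, ?_⟩
  rw [le_himp_iff, inf_comm, ← le_himp_iff]
  refine le_of_local f V _ fun x hx => ?_
  have key : ∃ A B : Opens ℝ, x ∈ A ∧ Metric.closedBall y r ⊆ B ∧ f A ⊓ g B ≤ T := by
    refine (isCompact_closedBall y r).induction_on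
      (p := fun K => ∃ A B : Opens ℝ, x ∈ A ∧ K ⊆ B ∧ f A ⊓ g B ≤ T) ?_ ?_ ?_ ?_
    · exact ⟨⊤, ⊥, trivial, Set.empty_subset _, by simp⟩
    · rintro K K' hK ⟨A, B, hA, hB, hle⟩
      exact ⟨A, B, hA, hK.trans hB, hle⟩
    · rintro K K' ⟨A, B, hA, hB, hle⟩ ⟨A', B', hA', hB', hle'⟩
      refine ⟨A ⊓ A', B ⊔ B', ⟨hA, hA'⟩, Set.union_subset_union hB hB', ?_⟩
      rw [map_sup, inf_sup_left]
      refine sup_le (le_trans ?_ hle) (le_trans ?_ hle')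
      · exact inf_le_inf_right _ (OrderHomClass.mono f inf_le_left)
      · exact inf_le_inf_right _ (OrderHomClass.mono f inf_le_right)
    · intro z hz
      obtain ⟨U, hU, hm⟩ := Opens.mem_sSup.1 (h x hx z (hrW hz))
      have hn : m ⁻¹' (U : Set ℝ) ∈ nhds (x, z) :=
        (U.isOpen.preimage m.continuous).mem_nhds hm
      rw [mem_nhds_prod_iff'] at hn
      obtain ⟨A, B, hA, hxA, hB, hzB, hAB⟩ := hn
      refine ⟨B, mem_nhdsWithin_of_mem_nhds (hB.mem_nhds hzB), ⟨A, hA⟩, ⟨B, hB⟩, hxA,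
        Set.Subset.refl _, ?_⟩
      rw [hT]
      refine le_iSup₂_of_le U hU (le_iSup_of_le ⟨A, hA⟩ (le_iSup₂_of_le ⟨B, hB⟩ ?_ le_rfl))
      exact fun x' hx' y' hy' => hAB (Set.mk_mem_prod hx' hy')
  obtain ⟨A, B, hA, hB, hle⟩ := key
  refine ⟨A, hA, ?_⟩
  rw [le_himp_iff]
  refine le_trans (inf_le_inf_left _ (OrderHomClass.mono g ?_)) hle
  exact fun z hz => hB (Metric.ball_subset_closedBall hz)

/-- The composite of `(f, g) : X → ℝ × ℝ` with a continuous map `m : ℝ × ℝ → ℝ`: the inverse image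
of `U` is the join of all `f⁻¹(V) ⊓ g⁻¹(W)` with `V × W ⊆ m⁻¹(U)`. -/
def map₂ (m : C(ℝ × ℝ, ℝ)) (f g : Loc L) : Loc L where
  preimage :=
    { toFun := fun U => ⨆ (V : Opens ℝ) (W : Opens ℝ) (_ : ∀ x ∈ V, ∀ y ∈ W, m (x, y) ∈ U),
        f.preimage V ⊓ g.preimage W
      map_inf' := by
        intro U U'
        apply le_antisymm
        · refine iSup_le fun V => iSup_le fun W => iSup_le fun h => le_inf ?_ ?_
          · exact le_iSup_of_le V (le_iSup₂_of_le W (fun x hx y hy => (h x hx y hy).1) le_rfl)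
          · exact le_iSup_of_le V (le_iSup₂_of_le W (fun x hx y hy => (h x hx y hy).2) le_rfl)
        · simp only [iSup_inf_eq, inf_iSup_eq]
          refine iSup_le fun V => iSup_le fun W => iSup_le fun h => ?_
          refine iSup_le fun V' => iSup_le fun W' => iSup_le fun h' => ?_
          refine le_iSup_of_le (V' ⊓ V) (le_iSup₂_of_le (W' ⊓ W)
            (fun x hx y hy => ⟨h' x hx.1 y hy.1, h x hx.2 y hy.2⟩) ?_)
          rw [map_inf, map_inf, inf_inf_inf_comm]
      map_top' := by
        refine top_unique ?_
        refine le_iSup_of_le ⊤ (le_iSup₂_of_le ⊤ (fun x _ y _ => trivial) ?_)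
        simp
      map_sSup' := by
        intro s
        apply le_antisymm
        · refine iSup_le fun V => iSup_le fun W => iSup_le fun h => ?_
          rw [sSup_image]
          exact tube m f.preimage g.preimage s V W h
        · refine sSup_le ?_
          rintro _ ⟨U, hU, rfl⟩
          refine iSup_le fun V => iSup_le fun W => iSup_le fun h => ?_
          exact le_iSup_of_le V (le_iSup₂_of_le W
            (fun x hx y hy => Opens.mem_sSup.2 ⟨U, hU, h x hx y hy⟩) le_rfl) }

/-- The f-algebra structure `inst` on `Loc(X, ℝ)` is the pointwise one: its operations are induced
by those of `ℝ`. -/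
structure IsPointwise (inst : FAlgebra (Loc L)) : Prop where
  add_eq : ∀ f g : Loc L, f + g = map₂ ⟨fun p => p.1 + p.2, by fun_prop⟩ f g
  smul_eq : ∀ (c : ℝ) (f : Loc L), c • f = map ⟨fun x => c * x, by fun_prop⟩ f
  mul_eq : ∀ f g : Loc L, f * g = map₂ ⟨fun p => p.1 * p.2, by fun_prop⟩ f g
  sup_eq : ∀ f g : Loc L, f ⊔ g = map₂ ⟨fun p => p.1 ⊔ p.2, by fun_prop⟩ f g
  inf_eq : ∀ f g : Loc L, f ⊓ g = map₂ ⟨fun p => p.1 ⊓ p.2, by fun_prop⟩ f g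

end Loc

/-! No points of Σ are used. Any three maps X → ℝ on a locale assemble to one map X → ℝ³
(`exists_pull`), and pulling back from ℝ³ respects all operations. So every identity of real
functions on ℝ³ holds in `Loc L`; order hypotheses are first rewritten as identities. An inequality
between pullbacks means that the open set where it fails has inverse image ⊥ (`pull_le_pull_iff`).

On the spectrum, `D` turns ⊔ and ⊓ into joins and meets. The hard direction, reading facts about R
off the presented frame, rests on `isSaturated_of_ideal`: a suitable ideal J of R yields a saturated
set, so D m ≤ ⋁ X puts m - s·u in J for every s > 0 as soon as J contains everything below the
members of X. Varying J gives faithfulness up to s·u, compactness of Σ, and Urysohn-type elements b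
with D b ≤ V and D (u - b) ≤ W whenever V ⊔ W = ⊤.

The map `eval` is a frame homomorphism by a Heine–Borel argument inside the frame, and it is a Riesz
morphism because half-lines determine a real function (`eval_eq`). Faithfulness up to s·u preserves
the norm. Compactness bounds every f, and the Urysohn elements cut the error of an approximation to
two thirds, as in Tietze's theorem; iteration gives density. -/

namespace Loc

/-! ### Maps of locales into Y × ℝ. -/

section Prod

variable {L : Type*} [Order.Frame L] {Y : Type*} [TopologicalSpace Y]

theorem le_of_forall_mem_exists (f : FrameHom (Opens Y) L) (V : Opens Y) (c : L)
    (h : ∀ x ∈ V, ∃ A : Opens Y, x ∈ A ∧ f A ≤ c) : f V ≤ c := by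
  have hV : V ≤ sSup {A : Opens Y | f A ≤ c} := fun x hx => by
    obtain ⟨A, hA, hc⟩ := h x hx
    exact Opens.mem_sSup.2 ⟨A, hc, hA⟩
  refine (OrderHomClass.mono f hV).trans ?_
  rw [map_sSup]
  refine sSup_le ?_
  rintro _ ⟨A, hA, rfl⟩
  exact hA

/-- A rectangle covered by `s` is below the join of the rectangles contained in members of `s`. -/
theorem rectangle_le (f : FrameHom (Opens Y) L) (g : FrameHom (Opens ℝ) L)
    (s : Set (Opens (Y × ℝ))) (V : Opens Y) (W : Opens ℝ)
    (h : ∀ x ∈ V, ∀ y ∈ W, (x, y) ∈ sSup s) :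
    f V ⊓ g W ≤ ⨆ U ∈ s, ⨆ (A : Opens Y) (B : Opens ℝ) (_ : ∀ x ∈ A, ∀ y ∈ B, (x, y) ∈ U),
      f A ⊓ g B := by
  set T : L := ⨆ U ∈ s, ⨆ (A : Opens Y) (B : Opens ℝ) (_ : ∀ x ∈ A, ∀ y ∈ B, (x, y) ∈ U),
      f A ⊓ g B with hT
  rw [inf_comm, ← le_himp_iff]
  refine le_of_local g W _ fun y hy => ?_
  obtain ⟨r, hr, hrW⟩ := Metric.nhds_basis_closedBall.mem_iff.1 (W.isOpen.mem_nhds hy)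
  refine ⟨⟨Metric.ball y r, Metric.isOpen_ball⟩, Metric.mem_ball_self hr, ?_⟩
  rw [le_himp_iff, inf_comm, ← le_himp_iff]
  refine le_of_forall_mem_exists f V _ fun x hx => ?_
  -- With x fixed, finitely many good rectangles cover {x} × closed ball; intersecting their first
  -- sides leaves a single neighbourhood of x.
  have key : ∃ A : Opens Y, ∃ B : Opens ℝ, x ∈ A ∧ Metric.closedBall y r ⊆ B ∧ f A ⊓ g B ≤ T := by
    refine (isCompact_closedBall y r).induction_on
      (p := fun K => ∃ A : Opens Y, ∃ B : Opens ℝ, x ∈ A ∧ K ⊆ B ∧ f A ⊓ g B ≤ T) ?_ ?_ ?_ ?_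
    · exact ⟨⊤, ⊥, trivial, Set.empty_subset _, by simp⟩
    · rintro K K' hK ⟨A, B, hA, hB, hle⟩
      exact ⟨A, B, hA, hK.trans hB, hle⟩
    · rintro K K' ⟨A, B, hA, hB, hle⟩ ⟨A', B', hA', hB', hle'⟩
      refine ⟨A ⊓ A', B ⊔ B', ⟨hA, hA'⟩, Set.union_subset_union hB hB', ?_⟩
      rw [map_sup, inf_sup_left]
      refine sup_le (le_trans ?_ hle) (le_trans ?_ hle')
      · exact inf_le_inf_right _ (OrderHomClass.mono f inf_le_left)
      · exact inf_le_inf_right _ (OrderHomClass.mono f inf_le_right)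
    · intro z hz
      obtain ⟨U, hU, hm⟩ := Opens.mem_sSup.1 (h x hx z (hrW hz))
      have hn : (U : Set (Y × ℝ)) ∈ nhds (x, z) := U.isOpen.mem_nhds hm
      rw [mem_nhds_prod_iff'] at hn
      obtain ⟨A, B, hA, hxA, hB, hzB, hAB⟩ := hn
      refine ⟨B, mem_nhdsWithin_of_mem_nhds (hB.mem_nhds hzB), ⟨A, hA⟩, ⟨B, hB⟩, hxA,
        Set.Subset.refl _, ?_⟩
      rw [hT]
      refine le_iSup₂_of_le U hU (le_iSup_of_le ⟨A, hA⟩ (le_iSup₂_of_le ⟨B, hB⟩ ?_ le_rfl))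
      exact fun x' hx' y' hy' => hAB (Set.mk_mem_prod hx' hy')
  obtain ⟨A, B, hA, hB, hle⟩ := key
  refine ⟨A, hA, ?_⟩
  rw [le_himp_iff]
  refine le_trans (inf_le_inf_left _ (OrderHomClass.mono g ?_)) hle
  exact fun z hz => hB (Metric.ball_subset_closedBall hz)

/-- The map `(f, g) : X → Y × ℝ` of locales with components `f : X → Y` and `g : X → ℝ`. -/
def prod (f : FrameHom (Opens Y) L) (g : FrameHom (Opens ℝ) L) :
    FrameHom (Opens (Y × ℝ)) L where
  toFun U := ⨆ (V : Opens Y) (W : Opens ℝ) (_ : ∀ x ∈ V, ∀ y ∈ W, (x, y) ∈ U), f V ⊓ g W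
  map_inf' U U' := by
    apply le_antisymm
    · refine iSup_le fun V => iSup_le fun W => iSup_le fun h => le_inf ?_ ?_
      · exact le_iSup_of_le V (le_iSup₂_of_le W (fun x hx y hy => (h x hx y hy).1) le_rfl)
      · exact le_iSup_of_le V (le_iSup₂_of_le W (fun x hx y hy => (h x hx y hy).2) le_rfl)
    · simp only [iSup_inf_eq, inf_iSup_eq]
      refine iSup_le fun V => iSup_le fun W => iSup_le fun h => ?_
      refine iSup_le fun V' => iSup_le fun W' => iSup_le fun h' => ?_
      refine le_iSup_of_le (V' ⊓ V) (le_iSup₂_of_le (W' ⊓ W)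
        (fun x hx y hy => ⟨h' x hx.1 y hy.1, h x hx.2 y hy.2⟩) ?_)
      rw [map_inf, map_inf, inf_inf_inf_comm]
  map_top' := by
    refine top_unique ?_
    refine le_iSup_of_le ⊤ (le_iSup₂_of_le ⊤ (fun x _ y _ => trivial) ?_)
    simp
  map_sSup' s := by
    apply le_antisymm
    · refine iSup_le fun V => iSup_le fun W => iSup_le fun h => ?_
      rw [sSup_image]
      exact rectangle_le f g s V W h
    · refine sSup_le ?_
      rintro _ ⟨U, hU, rfl⟩
      refine iSup_le fun V => iSup_le fun W => iSup_le fun h => ?_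
      exact le_iSup_of_le V (le_iSup₂_of_le W
        (fun x hx y hy => Opens.mem_sSup.2 ⟨U, hU, h x hx y hy⟩) le_rfl)

theorem prod_apply (f : FrameHom (Opens Y) L) (g : FrameHom (Opens ℝ) L) (U : Opens (Y × ℝ)) :
    prod f g U =
      ⨆ (V : Opens Y) (W : Opens ℝ) (_ : ∀ x ∈ V, ∀ y ∈ W, (x, y) ∈ U), f V ⊓ g W := rfl

theorem prod_comp_fst (f : FrameHom (Opens Y) L) (g : FrameHom (Opens ℝ) L) :
    (prod f g).comp (Opens.comap (ContinuousMap.fst : C(Y × ℝ, Y))) = f := by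
  ext U
  rw [FrameHom.comp_apply, prod_apply]
  apply le_antisymm
  · refine iSup_le fun V => iSup_le fun W => iSup_le fun h => ?_
    rcases (W : Set ℝ).eq_empty_or_nonempty with hW | ⟨y, hy⟩
    · have : W = ⊥ := Opens.ext hW
      simp [this]
    · exact inf_le_left.trans (OrderHomClass.mono f fun x hx => h x hx y hy)
  · exact le_iSup_of_le U (le_iSup₂_of_le ⊤ (fun x hx y _ => hx) (by simp))

theorem prod_comp_snd (f : FrameHom (Opens Y) L) (g : FrameHom (Opens ℝ) L) :
    (prod f g).comp (Opens.comap (ContinuousMap.snd : C(Y × ℝ, ℝ))) = g := by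
  ext U
  rw [FrameHom.comp_apply, prod_apply]
  apply le_antisymm
  · refine iSup_le fun V => iSup_le fun W => iSup_le fun h => ?_
    rcases (V : Set Y).eq_empty_or_nonempty with hV | ⟨x, hx⟩
    · have : V = ⊥ := Opens.ext hV
      simp [this]
    · exact inf_le_right.trans (OrderHomClass.mono g fun y hy => h x hx y hy)
  · exact le_iSup_of_le ⊤ (le_iSup₂_of_le U (fun x _ y hy => hy) (by simp))

end Prod

/-! ### Real functions pulled back from a space. -/

section Pull

variable {L : Type*} [Order.Frame L] {Y : Type*} [TopologicalSpace Y]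

/-- The composite of `F : X → Y` with a continuous function `a : Y → ℝ`. -/
def pull (F : FrameHom (Opens Y) L) (a : C(Y, ℝ)) : Loc L :=
  ⟨F.comp (Opens.comap a)⟩

theorem pull_preimage (F : FrameHom (Opens Y) L) (a : C(Y, ℝ)) (U : Opens ℝ) :
    (pull F a).preimage U = F (Opens.comap a U) := rfl

theorem map₂_pull (m : C(ℝ × ℝ, ℝ)) (F : FrameHom (Opens Y) L) (a b : C(Y, ℝ)) :
    map₂ m (pull F a) (pull F b) = pull F (m.comp (a.prodMk b)) := by
  ext U
  change (⨆ (V : Opens ℝ) (W : Opens ℝ) (_ : ∀ x ∈ V, ∀ y ∈ W, m (x, y) ∈ U),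
    F (Opens.comap a V) ⊓ F (Opens.comap b W)) = F (Opens.comap (m.comp (a.prodMk b)) U)
  apply le_antisymm
  · refine iSup_le fun V => iSup_le fun W => iSup_le fun h => ?_
    rw [← map_inf]
    exact OrderHomClass.mono F fun y hy => h _ hy.1 _ hy.2
  · refine le_of_forall_mem_exists F _ _ fun y hy => ?_
    have hn : m ⁻¹' (U : Set ℝ) ∈ nhds (a y, b y) :=
      (U.isOpen.preimage m.continuous).mem_nhds hy
    rw [mem_nhds_prod_iff'] at hn
    obtain ⟨A, B, hA, hxA, hB, hzB, hAB⟩ := hn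
    refine ⟨Opens.comap a ⟨A, hA⟩ ⊓ Opens.comap b ⟨B, hB⟩, ⟨hxA, hzB⟩, ?_⟩
    rw [map_inf]
    exact le_iSup_of_le ⟨A, hA⟩ (le_iSup₂_of_le ⟨B, hB⟩
      (fun x' hx' y' hy' => hAB (Set.mk_mem_prod hx' hy')) le_rfl)

open Classical in
theorem const_eq_pull (F : FrameHom (Opens Y) L) (r : ℝ) :
    const L r = pull F (ContinuousMap.const Y r) := by
  ext U
  change (if r ∈ U then ⊤ else ⊥) = F (Opens.comap (ContinuousMap.const Y r) U)
  split_ifs with h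
  · rw [← map_top F]
    congr 1
    ext y
    simpa using h
  · rw [← map_bot F]
    congr 1
    ext y
    simpa using h

/-- The witnesses are the map (f, g, h) : X → ℝ³ and the three coordinates. This reduces algebra in
`Loc L` to pointwise algebra of continuous functions. -/
theorem exists_pull (f g h : Loc L) :
    ∃ (F : FrameHom (Opens ((ℝ × ℝ) × ℝ)) L) (a b c : C((ℝ × ℝ) × ℝ, ℝ)),
      f = pull F a ∧ g = pull F b ∧ h = pull F c := by
  refine ⟨prod (prod f.preimage g.preimage) h.preimage,
    ContinuousMap.fst.comp ContinuousMap.fst, ContinuousMap.snd.comp ContinuousMap.fst,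
    ContinuousMap.snd, ?_, ?_, ?_⟩
  · refine Loc.ext ?_
    conv_lhs => rw [← prod_comp_fst f.preimage g.preimage,
      ← prod_comp_fst (prod f.preimage g.preimage) h.preimage]
    rfl
  · refine Loc.ext ?_
    conv_lhs => rw [← prod_comp_snd f.preimage g.preimage,
      ← prod_comp_fst (prod f.preimage g.preimage) h.preimage]
    rfl
  · exact Loc.ext (prod_comp_snd _ _).symm

end Pull

/-! ### The pointwise f-algebra structure. -/

section Algebra

variable {L : Type*} [Order.Frame L] {Y : Type*} [TopologicalSpace Y]

scoped instance : Add (Loc L) := ⟨map₂ ⟨fun p => p.1 + p.2, by fun_prop⟩⟩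
scoped instance : Mul (Loc L) := ⟨map₂ ⟨fun p => p.1 * p.2, by fun_prop⟩⟩
scoped instance : Max (Loc L) := ⟨map₂ ⟨fun p => p.1 ⊔ p.2, by fun_prop⟩⟩
scoped instance : Min (Loc L) := ⟨map₂ ⟨fun p => p.1 ⊓ p.2, by fun_prop⟩⟩
scoped instance : SMul ℝ (Loc L) := ⟨fun c => map ⟨fun x => c * x, by fun_prop⟩⟩
noncomputable scoped instance : Zero (Loc L) := ⟨const L 0⟩
scoped instance : Neg (Loc L) := ⟨map ⟨fun x => -x, by fun_prop⟩⟩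

variable (F : FrameHom (Opens Y) L) (a b : C(Y, ℝ))

theorem pull_add : pull F (a + b) = pull F a + pull F b :=
  (map₂_pull ⟨fun p => p.1 + p.2, by fun_prop⟩ F a b).symm
theorem pull_mul : pull F (a * b) = pull F a * pull F b :=
  (map₂_pull ⟨fun p => p.1 * p.2, by fun_prop⟩ F a b).symm
theorem pull_sup : pull F (a ⊔ b) = pull F a ⊔ pull F b :=
  (map₂_pull ⟨fun p => p.1 ⊔ p.2, by fun_prop⟩ F a b).symm
theorem pull_inf : pull F (a ⊓ b) = pull F a ⊓ pull F b :=
  (map₂_pull ⟨fun p => p.1 ⊓ p.2, by fun_prop⟩ F a b).symm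
theorem pull_smul (c : ℝ) : pull F (c • a) = c • pull F a := rfl
theorem pull_neg : pull F (-a) = -pull F a := rfl
theorem pull_zero : pull F 0 = 0 := (const_eq_pull F 0).symm
theorem pull_one : pull F 1 = const L 1 := (const_eq_pull F 1).symm

noncomputable scoped instance : NonUnitalRing (Loc L) where
  add_assoc f g h := by
    obtain ⟨F, a, b, c, rfl, rfl, rfl⟩ := exists_pull f g h
    simp only [← pull_add, add_assoc]
  zero_add f := by
    obtain ⟨F, a, b, c, rfl, -, -⟩ := exists_pull f f f
    simp only [← pull_zero F, ← pull_add, zero_add]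
  add_zero f := by
    obtain ⟨F, a, b, c, rfl, -, -⟩ := exists_pull f f f
    simp only [← pull_zero F, ← pull_add, add_zero]
  add_comm f g := by
    obtain ⟨F, a, b, c, rfl, rfl, -⟩ := exists_pull f g g
    simp only [← pull_add, add_comm]
  neg_add_cancel f := by
    obtain ⟨F, a, b, c, rfl, -, -⟩ := exists_pull f f f
    simp only [← pull_zero F, ← pull_add, ← pull_neg, neg_add_cancel]
  nsmul := nsmulRec
  zsmul := zsmulRec
  left_distrib f g h := by
    obtain ⟨F, a, b, c, rfl, rfl, rfl⟩ := exists_pull f g h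
    simp only [← pull_add, ← pull_mul, mul_add]
  right_distrib f g h := by
    obtain ⟨F, a, b, c, rfl, rfl, rfl⟩ := exists_pull f g h
    simp only [← pull_add, ← pull_mul, add_mul]
  zero_mul f := by
    obtain ⟨F, a, b, c, rfl, -, -⟩ := exists_pull f f f
    simp only [← pull_zero F, ← pull_mul, zero_mul]
  mul_zero f := by
    obtain ⟨F, a, b, c, rfl, -, -⟩ := exists_pull f f f
    simp only [← pull_zero F, ← pull_mul, mul_zero]
  mul_assoc f g h := by
    obtain ⟨F, a, b, c, rfl, rfl, rfl⟩ := exists_pull f g h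
    simp only [← pull_mul, mul_assoc]

theorem pull_sub : pull F (a - b) = pull F a - pull F b := by
  rw [sub_eq_add_neg, sub_eq_add_neg, pull_add, pull_neg]

scoped instance : Lattice (Loc L) :=
  Lattice.mk'
    (fun f g => by
      obtain ⟨F, a, b, c, rfl, rfl, -⟩ := exists_pull f g g
      simp only [← pull_sup, sup_comm])
    (fun f g h => by
      obtain ⟨F, a, b, c, rfl, rfl, rfl⟩ := exists_pull f g h
      simp only [← pull_sup, sup_assoc])
    (fun f g => by
      obtain ⟨F, a, b, c, rfl, rfl, -⟩ := exists_pull f g g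
      simp only [← pull_inf, inf_comm])
    (fun f g h => by
      obtain ⟨F, a, b, c, rfl, rfl, rfl⟩ := exists_pull f g h
      simp only [← pull_inf, inf_assoc])
    (fun f g => by
      obtain ⟨F, a, b, c, rfl, rfl, -⟩ := exists_pull f g g
      simp only [← pull_inf, ← pull_sup, sup_inf_self])
    (fun f g => by
      obtain ⟨F, a, b, c, rfl, rfl, -⟩ := exists_pull f g g
      simp only [← pull_inf, ← pull_sup, inf_sup_self])

noncomputable scoped instance instFAlgebra : FAlgebra (Loc L) where
  one_smul f := by
    obtain ⟨F, a, b, c, rfl, -, -⟩ := exists_pull f f f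
    rw [← pull_smul, one_smul]
  mul_smul r s f := by
    obtain ⟨F, a, b, c, rfl, -, -⟩ := exists_pull f f f
    simp only [← pull_smul, mul_smul]
  smul_zero r := by
    simp only [← pull_zero (prod (const L 0).preimage (const L 0).preimage), ← pull_smul, smul_zero]
  smul_add r f g := by
    obtain ⟨F, a, b, c, rfl, rfl, -⟩ := exists_pull f g g
    simp only [← pull_smul, ← pull_add, smul_add]
  add_smul r s f := by
    obtain ⟨F, a, b, c, rfl, -, -⟩ := exists_pull f f f
    simp only [← pull_smul, ← pull_add, add_smul]
  zero_smul f := by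
    obtain ⟨F, a, b, c, rfl, -, -⟩ := exists_pull f f f
    simp only [← pull_smul, ← pull_zero F, zero_smul]
  add_le_add_left f g hfg h := by
    rw [← sup_eq_right] at hfg ⊢
    -- An equation between pullbacks says nothing pointwise, so the hypothesis is substituted first;
    -- what remains is an identity valid for all f, g, h.
    nth_rw 2 [← hfg]
    obtain ⟨F, a, b, c, rfl, rfl, rfl⟩ := exists_pull f g h
    simp only [← pull_sup, ← pull_add, sup_add]
  smul_le_smul_of_nonneg_left r hr f g hfg := by
    rw [← sup_eq_right] at hfg ⊢
    nth_rw 2 [← hfg]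
    obtain ⟨F, a, b, c, rfl, rfl, -⟩ := exists_pull f g g
    simp only [← pull_sup, ← pull_smul]
    congr 1
    ext x
    simp [mul_max_of_nonneg _ _ hr]
  smul_assoc r f g := by
    obtain ⟨F, a, b, c, rfl, rfl, -⟩ := exists_pull f g g
    simp only [← pull_mul, ← pull_smul, smul_eq_mul, smul_mul_assoc]
  smul_comm r f g := by
    obtain ⟨F, a, b, c, rfl, rfl, -⟩ := exists_pull f g g
    simp only [← pull_mul, ← pull_smul, smul_eq_mul, mul_smul_comm]
  mul_nonneg f g hf hg := by
    rw [← sup_eq_right] at hf hg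
    rw [← hf, ← hg]
    obtain ⟨F, a, b, c, rfl, rfl, -⟩ := exists_pull f g g
    rw [← sup_eq_right]
    simp only [← pull_zero F, ← pull_sup, ← pull_mul]
    congr 1
    ext x
    simp [mul_nonneg]
  mul_left_inf_eq_zero f g h hfg hh := by
    -- An identity free of hypotheses: 0 ⊔ h is always nonnegative and f - f ⊓ g, g - f ⊓ g are
    -- always disjoint. The hypotheses then simplify it to the claim.
    have key : ((0 ⊔ h) * (f - f ⊓ g)) ⊓ (g - f ⊓ g) = 0 := by
      obtain ⟨F, a, b, c, rfl, rfl, rfl⟩ := exists_pull f g h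
      simp only [← pull_zero F, ← pull_sup, ← pull_inf, ← pull_sub, ← pull_mul]
      congr 1
      ext x
      rcases le_total (a x) (b x) with hab | hab
      · simp [hab]
      · simpa [hab] using mul_nonneg (le_max_left 0 (c x)) (sub_nonneg.2 hab)
    rwa [hfg, sub_zero, sub_zero, sup_eq_right.2 hh] at key
  mul_right_inf_eq_zero f g h hfg hh := by
    have key : ((f - f ⊓ g) * (0 ⊔ h)) ⊓ (g - f ⊓ g) = 0 := by
      obtain ⟨F, a, b, c, rfl, rfl, rfl⟩ := exists_pull f g h
      simp only [← pull_zero F, ← pull_sup, ← pull_inf, ← pull_sub, ← pull_mul]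
      congr 1
      ext x
      rcases le_total (a x) (b x) with hab | hab
      · simp [hab]
      · simpa [hab] using mul_nonneg (sub_nonneg.2 hab) (le_max_left 0 (c x))
    rwa [hfg, sub_zero, sub_zero, sup_eq_right.2 hh] at key

theorem isPointwise : IsPointwise (instFAlgebra : FAlgebra (Loc L)) :=
  ⟨fun _ _ => rfl, fun _ _ => rfl, fun _ _ => rfl, fun _ _ => rfl, fun _ _ => rfl⟩

theorem const_one_mul (f : Loc L) : const L 1 * f = f := by
  obtain ⟨F, a, b, c, rfl, -, -⟩ := exists_pull f f f
  rw [← pull_one F, ← pull_mul, one_mul]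

theorem mul_const_one (f : Loc L) : f * const L 1 = f := by
  obtain ⟨F, a, b, c, rfl, -, -⟩ := exists_pull f f f
  rw [← pull_one F, ← pull_mul, mul_one]

/-! ### Half-lines and the order. -/

/-- The open half-line `(r, ∞)`. -/
def above (r : ℝ) : Opens ℝ := ⟨Set.Ioi r, isOpen_Ioi⟩

/-- The open half-line `(-∞, r)`. -/
def below (r : ℝ) : Opens ℝ := ⟨Set.Iio r, isOpen_Iio⟩

theorem above_inf_below (f : Loc L) (r : ℝ) :
    f.preimage (above r) ⊓ f.preimage (below r) = ⊥ := by
  rw [← map_inf, ← map_bot f.preimage]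
  congr 1
  ext x
  simpa [above, below] using fun h : r < x => h.le

theorem sup_preimage_above_le (f g : Loc L) (r : ℝ) :
    (f ⊔ g).preimage (above r) ≤ f.preimage (above r) ⊔ g.preimage (above r) := by
  obtain ⟨F, a, b, c, rfl, rfl, -⟩ := exists_pull f g g
  simp only [← pull_sup, pull_preimage, ← map_sup]
  exact OrderHomClass.mono F fun x hx => (lt_sup_iff (a := r) (b := a x) (c := b x)).1 hx

theorem sup_preimage_below_le (f g : Loc L) (r : ℝ) :
    (f ⊔ g).preimage (below r) ≤ f.preimage (below r) ⊓ g.preimage (below r) := by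
  obtain ⟨F, a, b, c, rfl, rfl, -⟩ := exists_pull f g g
  simp only [← pull_sup, pull_preimage, ← map_inf]
  exact OrderHomClass.mono F fun x hx => (sup_lt_iff (a := r) (b := a x) (c := b x)).1 hx

theorem add_preimage_above_le (f g : Loc L) (r : ℝ) :
    (f + g).preimage (above r) ≤ ⨆ p : ℝ, f.preimage (above p) ⊓ g.preimage (above (r - p)) := by
  obtain ⟨F, a, b, c, rfl, rfl, -⟩ := exists_pull f g g
  simp only [← pull_add, pull_preimage, ← map_inf, ← map_iSup]
  refine OrderHomClass.mono F fun x (hx : r < a x + b x) => ?_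
  -- The midpoint of the nonempty interval from r - b x to a x.
  refine Opens.mem_iSup.2 ⟨(a x + (r - b x)) / 2, ?_, ?_⟩
  · change (a x + (r - b x)) / 2 < a x
    linarith
  · change r - (a x + (r - b x)) / 2 < b x
    linarith

theorem add_preimage_below_le (f g : Loc L) (r : ℝ) :
    (f + g).preimage (below r) ≤ ⨆ p : ℝ, f.preimage (below p) ⊓ g.preimage (below (r - p)) := by
  obtain ⟨F, a, b, c, rfl, rfl, -⟩ := exists_pull f g g
  simp only [← pull_add, pull_preimage, ← map_inf, ← map_iSup]
  refine OrderHomClass.mono F fun x (hx : a x + b x < r) => ?_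
  refine Opens.mem_iSup.2 ⟨(a x + (r - b x)) / 2, ?_, ?_⟩
  · change a x < (a x + (r - b x)) / 2
    linarith
  · change b x < r - (a x + (r - b x)) / 2
    linarith

theorem preimage_above_mono {f g : Loc L} (h : f ≤ g) (r : ℝ) :
    f.preimage (above r) ≤ g.preimage (above r) := by
  rw [← sup_eq_right] at h
  rw [← h]
  obtain ⟨F, a, b, c, rfl, rfl, -⟩ := exists_pull f g g
  simp only [← pull_sup, pull_preimage]
  exact OrderHomClass.mono F fun x hx => lt_of_lt_of_le hx (le_sup_left (a := a x) (b := b x))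

/-- The open set on which `b < a`. -/
def ltSet (b a : C(Y, ℝ)) : Opens Y := ⟨{x | b x < a x}, isOpen_lt b.continuous a.continuous⟩

variable {F a b}

/-- Outside `ltSet b a` the functions a ⊔ b and b agree, and F sends that set to ⊥, so their inverse
images coincide. -/
theorem pull_le_pull_of_ltSet (h : F (ltSet b a) = ⊥) : pull F a ≤ pull F b := by
  rw [← sup_eq_right, ← pull_sup]
  ext U
  rw [pull_preimage, pull_preimage]
  apply le_antisymm
  · calc F (Opens.comap (a ⊔ b) U) ≤ F (Opens.comap b U ⊔ ltSet b a) :=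
        OrderHomClass.mono F fun x (hx : a x ⊔ b x ∈ U) => by
          rcases le_or_gt (a x) (b x) with hab | hab
          · rw [sup_eq_right.2 hab] at hx
            exact Or.inl hx
          · exact Or.inr hab
      _ = F (Opens.comap b U) := by rw [map_sup, h, sup_bot_eq]
  · calc F (Opens.comap b U) ≤ F (Opens.comap (a ⊔ b) U ⊔ ltSet b a) :=
        OrderHomClass.mono F fun x (hx : b x ∈ U) => by
          rcases le_or_gt (a x) (b x) with hab | hab
          · refine Or.inl ?_
            change a x ⊔ b x ∈ U
            rwa [sup_eq_right.2 hab]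
          · exact Or.inr hab
      _ = F (Opens.comap (a ⊔ b) U) := by rw [map_sup, h, sup_bot_eq]

/-- The set where b < a is covered by the sets b < r < a. -/
theorem ltSet_eq_bot (h : ∀ r, (pull F a).preimage (above r) ⊓ (pull F b).preimage (below r) = ⊥) :
    F (ltSet b a) = ⊥ := by
  refine bot_unique (le_of_forall_mem_exists F _ _ fun x (hx : b x < a x) => ?_)
  obtain ⟨r, h₁, h₂⟩ := exists_between hx
  refine ⟨Opens.comap a (above r) ⊓ Opens.comap b (below r), ⟨h₂, h₁⟩, ?_⟩
  rw [map_inf]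
  exact (h r).le

theorem le_iff {f g : Loc L} :
    f ≤ g ↔ ∀ r, f.preimage (above r) ⊓ g.preimage (below r) = ⊥ := by
  constructor
  · intro h r
    exact bot_unique ((inf_le_inf_right _ (preimage_above_mono h r)).trans (above_inf_below g r).le)
  · intro h
    obtain ⟨F, a, b, c, rfl, rfl, -⟩ := exists_pull f g g
    exact pull_le_pull_of_ltSet (ltSet_eq_bot h)

theorem pull_le_pull_iff : pull F a ≤ pull F b ↔ F (ltSet b a) = ⊥ :=
  ⟨fun h => ltSet_eq_bot (le_iff.1 h), pull_le_pull_of_ltSet⟩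

end Algebra

end Loc

/-! ### Generators of a presented frame. -/

namespace PresentedFrame

variable {G : Type*} {rel : Finset G → Set (Finset G) → Prop}

theorem singleton_mem_of (g : G) : ({g} : Finset G) ∈ (of g : PresentedFrame rel).1 :=
  fun _ hS => hS

theorem of_le_iff {g : G} {S : PresentedFrame rel} : of g ≤ S ↔ {g} ∈ S.1 :=
  ⟨fun h => h (singleton_mem_of g), fun h _ hF => hF S h⟩

theorem of_le_of_rel {g : G} {C : Set (Finset G)} (hr : rel {g} C) {S : PresentedFrame rel}
    (h : ∀ B ∈ C, ∃ b, B = {b} ∧ of b ≤ S) : of g ≤ S := by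
  refine of_le_iff.2 (S.2.cover {g} C hr {g} (Finset.Subset.refl _) fun B hB H _ hBH => ?_)
  obtain ⟨b, rfl, hb⟩ := h B hB
  exact S.2.mono _ (of_le_iff.1 hb) H hBH

open Classical in
-- The sets F with F ∪ A ∈ S are again saturated, which handles one factor at a time: take A = {b}
-- first, then A = F.
theorem of_inf_of_le {a b : G} {S : PresentedFrame rel} (h : ({a, b} : Finset G) ∈ S.1) :
    of a ⊓ of b ≤ S := by
  have sat : ∀ A : Finset G, IsSaturated rel {F | F ∪ A ∈ S.1} := fun A =>
    ⟨fun F hF H hFH => S.2.mono _ hF _ (Finset.union_subset_union_left hFH),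
      fun A' C hr F hA hC => S.2.cover A' C hr _ (hA.trans Finset.subset_union_left)
        fun B hB H hFH hBH => by
          have := hC B hB H (Finset.subset_union_left.trans hFH) hBH
          rwa [Set.mem_ofPred_eq,
            Finset.union_eq_left.2 (Finset.subset_union_right.trans hFH)] at this⟩
  intro F hF
  have h₁ : of a ≤ ⟨_, sat {b}⟩ := of_le_iff.2 (by simpa [Finset.pair_comm] using h)
  have h₂ : F ∪ {b} ∈ S.1 := h₁ ((inf_le_left : of a ⊓ of b ≤ of a) hF)
  have h₃ : of b ≤ ⟨_, sat F⟩ := of_le_iff.2 (by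
    change {b} ∪ F ∈ S.1
    rwa [Finset.union_comm])
  have h₄ : F ∪ F ∈ S.1 := h₃ ((inf_le_right : of a ⊓ of b ≤ of b) hF)
  rwa [Finset.union_self] at h₄

end PresentedFrame

/-! ### Inequalities in Riesz spaces. -/

section Riesz

variable {R : Type*} [AddCommGroup R] [Lattice R] [Module ℝ R] {u : R}

theorem IsStrongUnit.exists_abs_le (hu : IsStrongUnit u) (a : R) :
    ∃ n : ℕ, |a| ≤ (n : ℝ) • u := by
  obtain ⟨n, hn⟩ := hu a
  exact ⟨n, by rwa [Nat.cast_smul_eq_nsmul]⟩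

variable [IsOrderedAddMonoid R] [PosSMulMono ℝ R]

theorem smul_le_smul_right_of_le {r s : ℝ} (h : r ≤ s) {a : R} (ha : 0 ≤ a) : r • a ≤ s • a := by
  rw [← sub_nonneg, ← sub_smul]
  exact smul_nonneg (sub_nonneg.2 h) ha

theorem two_inv_smul_add_le_sup (a b : R) : (2⁻¹ : ℝ) • (a + b) ≤ a ⊔ b := by
  refine (smul_le_smul_of_nonneg_left (add_le_add (le_sup_left : a ≤ a ⊔ b)
    (le_sup_right : b ≤ a ⊔ b)) (by norm_num)).trans_eq ?_
  module

theorem inf_le_two_inv_smul_add (a b : R) : a ⊓ b ≤ (2⁻¹ : ℝ) • (a + b) := by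
  refine le_trans (Eq.le ?_) (smul_le_smul_of_nonneg_left (add_le_add (inf_le_left : a ⊓ b ≤ a)
    (inf_le_right : a ⊓ b ≤ b)) (by norm_num))
  module

theorem smul_le_sup_zero {c : ℝ} (h₀ : 0 ≤ c) (h₁ : c ≤ 1) (a : R) : c • a ≤ a ⊔ 0 :=
  calc c • a ≤ c • (a ⊔ 0) := smul_le_smul_of_nonneg_left le_sup_left h₀
    _ ≤ (1 : ℝ) • (a ⊔ 0) := smul_le_smul_right_of_le h₁ le_sup_right
    _ = a ⊔ 0 := one_smul _ _

theorem IsStrongUnit.nonneg (hu : IsStrongUnit u) : 0 ≤ u := by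
  obtain ⟨n, hn⟩ := hu u
  have h : (0 : R) ≤ n • u := (abs_nonneg u).trans hn
  rcases Nat.eq_zero_or_pos n with rfl | hpos
  · rw [zero_smul] at hn
    exact neg_nonpos.1 ((neg_le_abs u).trans hn)
  · have hn' : (n : ℝ) ≠ 0 := by positivity
    have := smul_nonneg (by positivity : (0 : ℝ) ≤ (n : ℝ)⁻¹) h
    rwa [← Nat.cast_smul_eq_nsmul ℝ, inv_smul_smul₀ hn'] at this

end Riesz

/-! ### Calculus of the basic opens. -/

namespace Spectrum

open PresentedFrame

variable {R : Type*} [AddCommGroup R] [Lattice R] [Module ℝ R] {u : R}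

open Classical in
-- For a ∈ F one has a ⊔ m = a, so the relation `right` covers {m} by {a}; this lets the elements of
-- F be dropped one by one.
theorem singleton_mem (S : Spectrum u) {F : Finset R} (hF : F ∈ S.1) {m : R}
    (hm : ∀ a ∈ F, m ≤ a) : {m} ∈ S.1 := by
  have key : ∀ F : Finset R, (∀ a ∈ F, m ≤ a) → F ∪ {m} ∈ S.1 → {m} ∈ S.1 := by
    intro F
    induction F using Finset.induction_on with
    | empty => intro _ h; simpa using h
    | insert a F _ ih =>
      intro hm h
      refine ih (fun b hb => hm b (Finset.mem_insert_of_mem hb)) ?_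
      refine S.2.cover _ _ (SpectrumRel.right a m) _ (by simp) ?_
      rintro _ rfl H hFH haH
      rw [sup_eq_left.2 (hm a (Finset.mem_insert_self a F))] at haH
      refine S.2.mono _ h H ?_
      rw [Finset.insert_union]
      exact Finset.insert_subset (haH (Finset.mem_singleton_self a)) hFH
  exact key F hm (S.2.mono F hF _ Finset.subset_union_left)

theorem D_le_iff {a : R} {S : Spectrum u} : D u a ≤ S ↔ {a} ∈ S.1 := of_le_iff

theorem D_mono {a b : R} (h : a ≤ b) : D u a ≤ D u b :=
  D_le_iff.2 (singleton_mem _ (singleton_mem_of b) (by simpa using h))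

theorem D_add_le (a b : R) : D u (a + b) ≤ D u a ⊔ D u b := by
  refine of_le_of_rel (SpectrumRel.add a b) ?_
  rintro B (rfl | rfl)
  · exact ⟨a, rfl, le_sup_left⟩
  · exact ⟨b, rfl, le_sup_right⟩

theorem D_sup (a b : R) : D u (a ⊔ b) = D u a ⊔ D u b := by
  refine le_antisymm (of_le_of_rel (SpectrumRel.sup a b) ?_)
    (sup_le (D_mono le_sup_left) (D_mono le_sup_right))
  rintro B (rfl | rfl)
  · exact ⟨a, rfl, le_sup_left⟩
  · exact ⟨b, rfl, le_sup_right⟩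

theorem D_of_nonpos {a : R} (h : a ≤ 0) : D u a = ⊥ :=
  bot_unique (of_le_of_rel (SpectrumRel.nonpos a h) (by simp))

theorem D_le_of_forall_sub {a : R} {S : Spectrum u} (h : ∀ s : ℝ, 0 < s → D u (a - s • u) ≤ S) :
    D u a ≤ S := by
  refine of_le_of_rel (SpectrumRel.cont a) ?_
  rintro B ⟨s, hs, rfl⟩
  exact ⟨_, rfl, h s hs⟩

theorem D_unit : D u u = ⊤ :=
  top_unique fun F _ => (D u u).2.cover ∅ _ SpectrumRel.unit F (Finset.empty_subset F)
    fun B hB H _ hBH => by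
      rw [Set.mem_singleton_iff.1 hB] at hBH
      exact (D u u).2.mono _ (singleton_mem_of u) H hBH

theorem D_inf_D_neg (a : R) : D u a ⊓ D u (-a) = ⊥ :=
  bot_unique (of_inf_of_le ((⊥ : Spectrum u).2.cover _ _ (SpectrumRel.neg a) _
    (Finset.Subset.refl _) (by simp)))

variable [IsOrderedAddMonoid R]

/-- From x = x ⊓ y + (x - y)⁺ one gets D x ≤ D (x ⊓ y) ⊔ D (x - y). Applied both ways, the error
terms D (a - b) and D (b - a) are disjoint. -/
theorem D_inf (a b : R) : D u (a ⊓ b) = D u a ⊓ D u b := by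
  refine le_antisymm (le_inf (D_mono inf_le_left) (D_mono inf_le_right)) ?_
  have key : ∀ x y : R, D u x ≤ D u (x ⊓ y) ⊔ D u (x - y) := fun x y => by
    have h : x = x ⊓ y + (x - y) ⊔ 0 := by
      rw [← sub_self y, ← sup_sub, ← add_sub_assoc, inf_add_sup, add_sub_cancel_right]
    calc D u x = D u (x ⊓ y + (x - y) ⊔ 0) := congrArg _ h
      _ ≤ _ := D_add_le _ _
      _ = _ := by rw [D_sup, D_of_nonpos le_rfl, sup_bot_eq]
  calc D u a ⊓ D u b ≤ (D u (a ⊓ b) ⊔ D u (a - b)) ⊓ (D u (a ⊓ b) ⊔ D u (-(a - b))) := by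
        refine inf_le_inf (key a b) ?_
        rw [inf_comm, neg_sub]
        exact key b a
    _ = D u (a ⊓ b) := by rw [← sup_inf_left, D_inf_D_neg, sup_bot_eq]

variable [PosSMulMono ℝ R]

theorem D_inf_D_eq_bot {a b : R} (h : a + b ≤ 0) : D u a ⊓ D u b = ⊥ := by
  rw [← D_inf]
  refine D_of_nonpos ((inf_le_two_inv_smul_add a b).trans ?_)
  have := smul_le_smul_of_nonneg_left h (by norm_num : (0 : ℝ) ≤ 2⁻¹)
  rwa [smul_zero] at this

theorem D_smul_le {c : ℝ} (hc : 0 ≤ c) (a : R) : D u (c • a) ≤ D u a := by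
  have two : ∀ (n : ℕ) (x : R), D u ((2 ^ n : ℝ) • x) ≤ D u x := by
    intro n x
    induction n with
    | zero => simp
    | succ n ih =>
      rw [show (2 ^ (n + 1) : ℝ) • x = (2 ^ n : ℝ) • x + (2 ^ n : ℝ) • x by module]
      exact (D_add_le _ _).trans (sup_le ih ih)
  obtain ⟨n, hn⟩ := pow_unbounded_of_one_lt c (one_lt_two : (1 : ℝ) < 2)
  -- Enlarging the scalar to a power of 2 needs a nonnegative element; passing to a ⊔ 0 does not
  -- change D.
  calc D u (c • a) ≤ D u ((2 ^ n : ℝ) • (a ⊔ 0)) := D_mono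
        ((smul_le_smul_of_nonneg_left le_sup_left hc).trans
          (smul_le_smul_right_of_le hn.le le_sup_right))
    _ ≤ D u (a ⊔ 0) := two n _
    _ = D u a := by rw [D_sup, D_of_nonpos le_rfl, sup_bot_eq]

theorem D_smul {c : ℝ} (hc : 0 < c) (a : R) : D u (c • a) = D u a := by
  refine le_antisymm (D_smul_le hc.le a) ?_
  have := D_smul_le (u := u) (inv_nonneg.2 hc.le) (c • a)
  rwa [inv_smul_smul₀ hc.ne'] at this

theorem D_inf_le_D_add (a b : R) : D u a ⊓ D u b ≤ D u (a + b) := by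
  rw [← D_inf, ← D_smul (by norm_num : (0 : ℝ) < 2⁻¹) (a + b)]
  exact D_mono (inf_le_two_inv_smul_add a b)

theorem D_smul_unit {c : ℝ} (hc : 0 < c) : D u (c • u) = ⊤ := by
  rw [D_smul hc, D_unit]

/-! ### From covers in the frame to ideals of R. -/

/-- If `J` is closed under `⊔`, doubling and smaller elements, then the finite sets all of whose
lower bounds are approximated from below by `J` form a saturated set. -/
theorem isSaturated_of_ideal (hu : IsStrongUnit u) {J : R → Prop} (anti : ∀ a b, a ≤ b → J b → J a)
    (zero : J 0) (sup : ∀ a b, J a → J b → J (a ⊔ b)) (two : ∀ a, J a → J ((2 : ℝ) • a)) :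
    IsSaturated (SpectrumRel u)
      {F | ∀ m : R, (∀ a ∈ F, m ≤ a) → ∀ s : ℝ, 0 < s → J (m - s • u)} := by
  classical
  let _ : DistribLattice R := AddCommGroup.toDistribLattice R
  set I : R → Prop := fun m => ∀ s : ℝ, 0 < s → J (m - s • u) with hI
  have Ianti : ∀ a b, a ≤ b → I b → I a := fun a b hab hb s hs =>
    anti _ _ (sub_le_sub_right hab _) (hb s hs)
  have Inonpos : ∀ a, a ≤ 0 → I a := fun a ha s hs =>
    anti _ _ (sub_nonpos.2 (ha.trans (smul_nonneg hs.le hu.nonneg))) zero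
  have Isup : ∀ a b, I a → I b → I (a ⊔ b) := fun a b ha hb s hs => by
    rw [sup_sub]
    exact sup _ _ (ha s hs) (hb s hs)
  have Itwo : ∀ a, I a → I ((2 : ℝ) • a) := fun a ha s hs => by
    have := two _ (ha (s / 2) (half_pos hs))
    rwa [smul_sub, smul_smul, mul_div_cancel₀ s two_ne_zero] at this
  have Icont : ∀ a, (∀ s : ℝ, 0 < s → I (a - s • u)) → I a := fun a ha s hs => by
    have := ha (s / 2) (half_pos hs) (s / 2) (half_pos hs)
    rwa [sub_sub, ← add_smul, add_halves] at this
  -- The strong unit enters here: m ≤ 2ⁿ·u gives m ≤ 2ⁿ·((m ⊓ u) ⊔ 0), which n doublings reach.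
  have Iunit : ∀ m, I (m ⊓ u) → I m := fun m hm => by
    obtain ⟨n, hn⟩ := hu.exists_abs_le m
    have hpow : ∀ k : ℕ, I ((2 ^ k : ℝ) • ((m ⊓ u) ⊔ 0)) := fun k => by
      induction k with
      | zero => simpa using Isup _ _ hm (Inonpos 0 le_rfl)
      | succ k ih =>
        rw [pow_succ', mul_smul]
        exact Itwo _ ih
    refine Ianti _ _ ?_ (hpow n)
    have hc : (0 : ℝ) < 2 ^ n := by positivity
    have hmu : m ≤ (2 ^ n : ℝ) • u := (le_abs_self m).trans (hn.trans
      (smul_le_smul_right_of_le (by exact_mod_cast Nat.lt_two_pow_self.le) hu.nonneg))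
    have h₁ : (2 ^ n : ℝ)⁻¹ • m ≤ u := by
      have := smul_le_smul_of_nonneg_left hmu (inv_nonneg.2 hc.le)
      rwa [inv_smul_smul₀ hc.ne'] at this
    have h₂ : (2 ^ n : ℝ)⁻¹ • m ≤ m ⊔ 0 :=
      smul_le_sup_zero (inv_nonneg.2 hc.le) (inv_le_one_of_one_le₀ (one_le_pow₀ one_le_two)) m
    have h₃ : (2 ^ n : ℝ)⁻¹ • m ≤ (m ⊓ u) ⊔ 0 := by
      rw [sup_inf_right]
      exact le_inf h₂ (h₁.trans le_sup_left)
    have := smul_le_smul_of_nonneg_left h₃ hc.le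
    rwa [smul_inv_smul₀ hc.ne'] at this
  have lower : ∀ {F H : Finset R} {m a : R}, (∀ x ∈ F, m ≤ x) → H ⊆ insert a F →
      ∀ x ∈ H, m ⊓ a ≤ x := fun {F H m a} hm hH x hx => by
    rcases Finset.mem_insert.1 (hH hx) with rfl | h
    · exact inf_le_right
    · exact inf_le_left.trans (hm x h)
  change IsSaturated (SpectrumRel u) {F | ∀ m : R, (∀ a ∈ F, m ≤ a) → I m}
  refine ⟨fun F hF H hFH m hm => hF m fun a ha => hm a (hFH ha), ?_⟩
  intro A C hr F hA hC m hm
  -- The cover hypothesis is applied to F with b adjoined, of which m ⊓ b is a lower bound.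
  have use : ∀ b : R, {b} ∈ C → I (m ⊓ b) := fun b hb =>
    hC {b} hb (insert b F) (Finset.subset_insert b F) (by simp) _
      (lower hm (Finset.Subset.refl _))
  have mem : ∀ b ∈ A, m ≤ b := fun b hb => hm b (hA hb)
  cases hr with
  | nonpos a h => exact Inonpos m ((mem a (by simp)).trans h)
  | unit => exact Iunit m (use u rfl)
  | neg a =>
    refine Inonpos m ?_
    have h := add_le_add (mem a (by simp)) (mem (-a) (by simp))
    have := smul_le_smul_of_nonneg_left h (by norm_num : (0 : ℝ) ≤ 2⁻¹)
    rwa [add_neg_cancel, smul_zero, show (2⁻¹ : ℝ) • (m + m) = m by module] at this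
  | add a b =>
    have h := Isup _ _ (Isup _ _ (use a (by simp)) (use b (by simp))) (Inonpos 0 le_rfl)
    refine Ianti _ _ ?_ (Itwo _ h)
    -- Half of m lies below m ⊔ 0, and below a ⊔ b since m ≤ a + b; distributivity combines the two.
    have h' : (2⁻¹ : ℝ) • m ≤ (m ⊓ a ⊔ m ⊓ b) ⊔ 0 := by
      rw [← inf_sup_left, sup_inf_right]
      refine le_inf (smul_le_sup_zero (by norm_num) (by norm_num) m) (le_sup_of_le_left ?_)
      exact (smul_le_smul_of_nonneg_left (mem (a + b) (by simp)) (by norm_num)).trans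
        (two_inv_smul_add_le_sup a b)
    have := smul_le_smul_of_nonneg_left h' (zero_le_two : (0 : ℝ) ≤ 2)
    rwa [smul_inv_smul₀ two_ne_zero] at this
  | sup a b =>
    have h := Isup _ _ (use a (by simp)) (use b (by simp))
    rwa [← inf_sup_left, inf_eq_left.2 (mem (a ⊔ b) (by simp))] at h
  | left a b =>
    have h := use (a ⊔ b) rfl
    rwa [inf_eq_left.2 ((mem a (by simp)).trans le_sup_left)] at h
  | right a b =>
    have h := use (a ⊔ b) rfl
    rwa [inf_eq_left.2 ((mem b (by simp)).trans le_sup_right)] at h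
  | cont a =>
    refine Icont m fun s hs => Ianti _ _ ?_ (use _ ⟨s, hs, rfl⟩)
    have hsu : (0 : R) ≤ s • u := smul_nonneg hs.le hu.nonneg
    exact le_inf (sub_le_self m hsu) (sub_le_sub_right (mem a (by simp)) _)
  | cont' a s hs =>
    have h := use a rfl
    have hsu : (0 : R) ≤ s • u := smul_nonneg hs.le hu.nonneg
    rwa [inf_eq_left.2 ((mem (a - s • u) (by simp)).trans (sub_le_self a hsu))] at h

/-- The saturated set built from J is an upper bound of X, hence lies above ⋁ X and contains {m}. -/
theorem ideal_of_D_le_sSup (hu : IsStrongUnit u) {J : R → Prop} (anti : ∀ a b, a ≤ b → J b → J a)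
    (zero : J 0) (sup : ∀ a b, J a → J b → J (a ⊔ b)) (two : ∀ a, J a → J ((2 : ℝ) • a))
    {X : Set (Spectrum u)} (hX : ∀ S ∈ X, ∀ m, D u m ≤ S → J m) {m : R} (hm : D u m ≤ sSup X)
    {s : ℝ} (hs : 0 < s) : J (m - s • u) := by
  have h : sSup X ≤ ⟨_, isSaturated_of_ideal hu anti zero sup two⟩ :=
    sSup_le fun S hS F hF x hx t ht =>
      anti _ x (sub_le_self x (smul_nonneg ht.le hu.nonneg))
        (hX S hS x (D_le_iff.2 (singleton_mem S hF hx)))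
  exact D_le_iff.1 (hm.trans h) m (by simp) s hs

theorem le_smul_of_D_eq_bot (hu : IsStrongUnit u) {a : R} (h : D u a = ⊥) {s : ℝ} (hs : 0 < s) :
    a ≤ s • u := by
  rw [← sub_nonpos]
  refine ideal_of_D_le_sSup (J := fun a => a ≤ 0) (X := ∅) hu (fun _ _ => le_trans) le_rfl
    (fun _ _ => sup_le) (fun a ha => ?_) (by simp) (by simp [h]) hs
  simpa using smul_le_smul_of_nonneg_left ha (zero_le_two : (0 : ℝ) ≤ 2)

theorem ideal_unit_of_sSup_eq_top (hu : IsStrongUnit u) {J : R → Prop}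
    (anti : ∀ a b, a ≤ b → J b → J a) (zero : J 0) (sup : ∀ a b, J a → J b → J (a ⊔ b))
    (two : ∀ a, J a → J ((2 : ℝ) • a)) {X : Set (Spectrum u)}
    (hX : ∀ S ∈ X, ∀ m, D u m ≤ S → J m) (h : sSup X = ⊤) : J u := by
  -- Starting from 2·u with s = 1 leaves exactly u.
  have := ideal_of_D_le_sSup hu anti zero sup two hX (m := (2 : ℝ) • u) (h ▸ le_top) one_pos
  rwa [← sub_smul, show (2 - 1 : ℝ) = 1 by norm_num, one_smul] at this

/-- Compactness of Σ for increasing sequences: the ideal consists of the a with D a below some S n.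
-/
theorem exists_eq_top_of_iSup_eq_top (hu : IsStrongUnit u) {S : ℕ → Spectrum u} (hS : Monotone S)
    (h : ⨆ n, S n = ⊤) : ∃ n, S n = ⊤ := by
  have : ∃ n, D u u ≤ S n := by
    refine ideal_unit_of_sSup_eq_top (J := fun a => ∃ n, D u a ≤ S n) (X := Set.range S) hu
      ?_ ⟨0, by simp [D_of_nonpos le_rfl]⟩ ?_ ?_ ?_ h
    · rintro a b hab ⟨n, hn⟩
      exact ⟨n, (D_mono hab).trans hn⟩
    · rintro a b ⟨n, hn⟩ ⟨k, hk⟩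
      refine ⟨max n k, ?_⟩
      rw [D_sup]
      exact sup_le (hn.trans (hS (le_max_left n k))) (hk.trans (hS (le_max_right n k)))
    · rintro a ⟨n, hn⟩
      exact ⟨n, (D_smul_le zero_le_two a).trans hn⟩
    · rintro _ ⟨n, rfl⟩ m hm
      exact ⟨n, hm⟩
  obtain ⟨n, hn⟩ := this
  exact ⟨n, top_unique (D_unit.ge.trans hn)⟩

/-- A Urysohn lemma. The ideal of all x ≤ a ⊔ c with a, c ≥ 0, D a ≤ V and D c ≤ W contains u; then
b = a ⊓ u works because u - b ≤ (c - a)⁺. -/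
theorem exists_D_le_of_sup_eq_top (hu : IsStrongUnit u) {V W : Spectrum u} (h : V ⊔ W = ⊤) :
    ∃ b : R, 0 ≤ b ∧ b ≤ u ∧ D u b ≤ V ∧ D u (u - b) ≤ W := by
  have : ∃ a c : R, 0 ≤ a ∧ 0 ≤ c ∧ D u a ≤ V ∧ D u c ≤ W ∧ u ≤ a ⊔ c := by
    have hpos : ∀ (m : R) (S : Spectrum u), D u m ≤ S → D u (m ⊔ 0) ≤ S := fun m S hm => by
      rwa [D_sup, D_of_nonpos le_rfl, sup_bot_eq]
    have hzero : ∀ S : Spectrum u, D u 0 ≤ S := fun S => by simp [D_of_nonpos le_rfl]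
    refine ideal_unit_of_sSup_eq_top (X := {V, W})
      (J := fun x => ∃ a c : R, 0 ≤ a ∧ 0 ≤ c ∧ D u a ≤ V ∧ D u c ≤ W ∧ x ≤ a ⊔ c) hu
      ?_ ⟨0, 0, le_rfl, le_rfl, hzero V, hzero W, by simp⟩ ?_ ?_ ?_ (by rwa [sSup_pair])
    · rintro x y hxy ⟨a, c, ha, hc, hV, hW, h⟩
      exact ⟨a, c, ha, hc, hV, hW, hxy.trans h⟩
    · rintro x y ⟨a, c, ha, hc, hV, hW, h⟩ ⟨a', c', ha', hc', hV', hW', h'⟩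
      refine ⟨a ⊔ a', c ⊔ c', ha.trans le_sup_left, hc.trans le_sup_left, ?_, ?_, ?_⟩
      · rw [D_sup]
        exact sup_le hV hV'
      · rw [D_sup]
        exact sup_le hW hW'
      · rw [sup_sup_sup_comm]
        exact sup_le_sup h h'
    · rintro x ⟨a, c, ha, hc, hV, hW, h⟩
      have two : (0 : ℝ) ≤ 2 := zero_le_two
      refine ⟨(2 : ℝ) • a, (2 : ℝ) • c, smul_nonneg two ha, smul_nonneg two hc,
        (D_smul_le two a).trans hV, (D_smul_le two c).trans hW, ?_⟩
      have h' : x ≤ (2⁻¹ : ℝ) • ((2 : ℝ) • a ⊔ (2 : ℝ) • c) := by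
        refine h.trans (sup_le ?_ ?_)
        · have := smul_le_smul_of_nonneg_left
            (le_sup_left : (2 : ℝ) • a ≤ (2 : ℝ) • a ⊔ (2 : ℝ) • c) (inv_nonneg.2 two)
          rwa [inv_smul_smul₀ two_ne_zero] at this
        · have := smul_le_smul_of_nonneg_left
            (le_sup_right : (2 : ℝ) • c ≤ (2 : ℝ) • a ⊔ (2 : ℝ) • c) (inv_nonneg.2 two)
          rwa [inv_smul_smul₀ two_ne_zero] at this
      have := smul_le_smul_of_nonneg_left h' two
      rwa [smul_inv_smul₀ two_ne_zero] at this
    · rintro S (rfl | rfl) m hm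
      · exact ⟨m ⊔ 0, 0, le_sup_right, le_rfl, hpos m _ hm, hzero W,
          le_sup_left.trans le_sup_left⟩
      · exact ⟨0, m ⊔ 0, le_rfl, le_sup_right, hzero V, hpos m _ hm,
          le_sup_left.trans le_sup_right⟩
  obtain ⟨a, c, ha, hc, hV, hW, h⟩ := this
  refine ⟨a ⊓ u, le_inf ha hu.nonneg, inf_le_right, (D_mono inf_le_left).trans hV,
    le_trans ?_ hW⟩
  have h' : u - a ⊓ u ≤ (c - a) ⊔ 0 := by
    rw [sub_le_iff_le_add, add_inf, sup_add, sub_add_cancel, zero_add]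
    exact le_inf (h.trans_eq (sup_comm a c)) (le_add_of_nonneg_left le_sup_right)
  calc D u (u - a ⊓ u) ≤ D u ((c - a) ⊔ 0) := D_mono h'
    _ = D u (c - a) := by rw [D_sup, D_of_nonpos le_rfl, sup_bot_eq]
    _ ≤ D u c := D_mono (sub_le_self c ha)

end Spectrum

/-! ### Constants, scalars and half-lines. -/

namespace Loc

variable {L : Type*} [Order.Frame L]

theorem const_preimage_of_notMem {c : ℝ} {U : Opens ℝ} (h : c ∉ U) :
    (const L c).preimage U = ⊥ := if_neg h

theorem smul_const (c r : ℝ) : c • const L r = const L (c * r) := by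
  obtain ⟨F, -⟩ := exists_pull (0 : Loc L) 0 0
  rw [const_eq_pull F, const_eq_pull F, ← pull_smul]
  rfl

theorem smul_const_one (c : ℝ) : c • const L 1 = const L c := by
  rw [smul_const, mul_one]

theorem neg_const (r : ℝ) : -const L r = const L (-r) := by
  rw [← neg_one_smul ℝ, smul_const, neg_one_mul]

theorem abs_le_const {f : Loc L} {r : ℝ} (h₁ : const L (-r) ≤ f) (h₂ : f ≤ const L r) :
    |f| ≤ const L r :=
  sup_le h₂ (by rwa [neg_le, neg_const])

theorem smul_preimage_above_of_pos {c : ℝ} (hc : 0 < c) (f : Loc L) (r : ℝ) :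
    (c • f).preimage (above r) = f.preimage (above (c⁻¹ * r)) := by
  refine congrArg f.preimage (Opens.ext (Set.ext fun x => ?_))
  exact (inv_mul_lt_iff₀ hc).symm

theorem smul_preimage_below_of_pos {c : ℝ} (hc : 0 < c) (f : Loc L) (r : ℝ) :
    (c • f).preimage (below r) = f.preimage (below (c⁻¹ * r)) := by
  refine congrArg f.preimage (Opens.ext (Set.ext fun x => ?_))
  exact (lt_inv_mul_iff₀ hc).symm

theorem neg_preimage_above (f : Loc L) (r : ℝ) :
    (-f).preimage (above r) = f.preimage (below (-r)) := by
  refine congrArg f.preimage (Opens.ext (Set.ext fun x => ?_))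
  exact lt_neg (a := r) (b := x)

theorem neg_preimage_below (f : Loc L) (r : ℝ) :
    (-f).preimage (below r) = f.preimage (above (-r)) := by
  refine congrArg f.preimage (Opens.ext (Set.ext fun x => ?_))
  exact neg_lt (a := x) (b := r)

end Loc

/-! ### Intervals in the spectrum and evaluation. -/

namespace Spectrum

variable {R : Type*} [AddCommGroup R] [Lattice R] [IsOrderedAddMonoid R] [Module ℝ R] {u : R}

/-- The basic open `{σ | p < σ a < q}`. -/
def between (u a : R) (p q : ℝ) : Spectrum u := D u ((a - p • u) ⊓ (q • u - a))

theorem between_eq (a : R) (p q : ℝ) :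
    between u a p q = D u (a - p • u) ⊓ D u (q • u - a) := D_inf _ _

variable [PosSMulMono ℝ R]

theorem D_sub_smul_anti (hu : 0 ≤ u) (a : R) {p q : ℝ} (h : p ≤ q) :
    D u (a - q • u) ≤ D u (a - p • u) :=
  D_mono (sub_le_sub_left (smul_le_smul_right_of_le h hu) a)

theorem D_smul_sub_mono (hu : 0 ≤ u) (a : R) {p q : ℝ} (h : p ≤ q) :
    D u (p • u - a) ≤ D u (q • u - a) :=
  D_mono (sub_le_sub_right (smul_le_smul_right_of_le h hu) a)

theorem between_mono (hu : 0 ≤ u) (a : R) {p q p' q' : ℝ} (hp : p ≤ p') (hq : q' ≤ q) :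
    between u a p' q' ≤ between u a p q := by
  rw [between_eq, between_eq]
  exact inf_le_inf (D_sub_smul_anti hu a hp) (D_smul_sub_mono hu a hq)

theorem between_eq_bot (hu : 0 ≤ u) (a : R) {p q : ℝ} (h : q ≤ p) : between u a p q = ⊥ := by
  rw [between_eq]
  refine D_inf_D_eq_bot ?_
  rw [show a - p • u + (q • u - a) = q • u - p • u by abel, sub_nonpos]
  exact smul_le_smul_right_of_le h hu

theorem between_le_between (hu : 0 ≤ u) (a : R) {p q p' q' : ℝ}
    (h : Set.Ioo p' q' ⊆ Set.Ioo p q) : between u a p' q' ≤ between u a p q := by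
  rcases le_or_gt q' p' with h' | h'
  · simp [between_eq_bot hu a h']
  · obtain ⟨hp, hq⟩ := (Set.Ioo_subset_Ioo_iff h').1 h
    exact between_mono hu a hp hq

theorem D_sub_sup_D_sub_eq_top (a : R) {r s : ℝ} (h : r < s) :
    D u (a - r • u) ⊔ D u (s • u - a) = ⊤ := by
  refine top_unique ((D_smul_unit (sub_pos.2 h)).ge.trans ?_)
  rw [show (s - r) • u = a - r • u + (s • u - a) by module]
  exact D_add_le _ _

theorem between_le_sup (a : R) {p q r s : ℝ} (h : r < s) :
    between u a p q ≤ between u a p s ⊔ between u a r q := by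
  simp only [between_eq]
  calc _ ≤ (D u (a - p • u) ⊓ D u (q • u - a)) ⊓ (D u (a - r • u) ⊔ D u (s • u - a)) := by
        rw [D_sub_sup_D_sub_eq_top a h, inf_top_eq]
    _ ≤ _ := by
        rw [inf_sup_left, sup_comm]
        refine sup_le_sup (inf_le_inf_right _ inf_le_left) ?_
        rw [inf_comm (D u (a - p • u)), inf_assoc, inf_comm]
        exact inf_le_inf_right _ inf_le_right

theorem exists_D_eq_top (hu : IsStrongUnit u) (a : R) :
    ∃ n : ℝ, D u (a - (-n) • u) = ⊤ ∧ ∀ m, n ≤ m → D u (m • u - a) = ⊤ := by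
  obtain ⟨n, hn⟩ := hu.exists_abs_le a
  -- The extra 1 makes m·u - b at least u, where D is already ⊤.
  have key : ∀ b : R, b ≤ (n : ℝ) • u → ∀ m : ℝ, n + 1 ≤ m → D u (m • u - b) = ⊤ := by
    intro b hb m hm
    refine top_unique (D_unit.ge.trans (D_mono ?_))
    rw [le_sub_iff_add_le]
    calc u + b ≤ u + (n : ℝ) • u := by gcongr
      _ = ((n : ℝ) + 1) • u := by module
      _ ≤ m • u := smul_le_smul_right_of_le hm hu.nonneg
  refine ⟨n + 1, ?_, key a ((le_abs_self a).trans hn)⟩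
  have := key (-a) ((neg_le_abs a).trans hn) (n + 1) le_rfl
  rwa [show a - (-((n : ℝ) + 1)) • u = ((n : ℝ) + 1) • u - -a by module]

/-- Compactness of closed intervals, in the spectrum. -/
theorem between_le_of_Icc_subset (hu : 0 ≤ u) (a : R) {s : Set (Opens ℝ)} {T : Spectrum u}
    (hT : ∀ U ∈ s, ∀ p q : ℝ, Set.Ioo p q ⊆ U → between u a p q ≤ T) {p q : ℝ}
    (h : Set.Icc p q ⊆ (sSup s : Opens ℝ)) : between u a p q ≤ T := by
  rcases lt_or_ge q p with hqp | hpq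
  · simp [between_eq_bot hu a hqp.le]
  -- Heine–Borel by suprema: a member of s around sup A carries the bound by T past sup A unless q
  -- is reached.
  set A : Set ℝ := {x | x ∈ Set.Icc p q ∧ between u a p x ≤ T} with hA
  have hpA : p ∈ A := ⟨Set.left_mem_Icc.2 hpq, by simp [between_eq_bot hu a le_rfl]⟩
  have hbdd : BddAbove A := ⟨q, fun x hx => hx.1.2⟩
  have hpc : p ≤ sSup A := le_csSup hbdd hpA
  have hcq : sSup A ≤ q := csSup_le ⟨p, hpA⟩ fun x hx => hx.1.2
  obtain ⟨U, hU, hcU⟩ := Opens.mem_sSup.1 (h ⟨hpc, hcq⟩)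
  obtain ⟨δ, hδ, hball⟩ := Metric.mem_nhds_iff.1 (U.isOpen.mem_nhds hcU)
  rw [Real.ball_eq_Ioo] at hball
  obtain ⟨x, hx, hcx⟩ := exists_lt_of_lt_csSup ⟨p, hpA⟩ (sub_lt_self (sSup A) hδ)
  have hy : between u a p (min q (sSup A + δ)) ≤ T :=
    (between_le_sup a hcx).trans (sup_le hx.2 ((between_mono hu a le_rfl (min_le_right _ _)).trans
      (hT U hU _ _ hball)))
  rcases le_or_gt q (sSup A + δ) with hq | hq
  · rwa [min_eq_left hq] at hy
  · rw [min_eq_right hq.le] at hy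
    have := le_csSup hbdd (show sSup A + δ ∈ A from ⟨⟨by linarith, hq.le⟩, hy⟩)
    linarith

/-- The relation `cont` exhausts the open interval by the closed intervals [p + t, q - t], to which
compactness applies. -/
theorem between_le_of_Ioo_subset (hu : 0 ≤ u) (a : R) {s : Set (Opens ℝ)} {T : Spectrum u}
    (hT : ∀ U ∈ s, ∀ p q : ℝ, Set.Ioo p q ⊆ U → between u a p q ≤ T) {p q : ℝ}
    (h : Set.Ioo p q ⊆ (sSup s : Opens ℝ)) : between u a p q ≤ T := by
  refine D_le_of_forall_sub fun t ht => ?_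
  have hle := between_le_of_Icc_subset hu a hT (p := p + t) (q := q - t)
    ((Set.Icc_subset_Ioo (by linarith) (by linarith)).trans h)
  refine le_trans (le_of_eq ?_) hle
  rw [between, inf_sub, show a - p • u - t • u = a - (p + t) • u by module,
    show q • u - a - t • u = (q - t) • u - a by module]

/-- The continuous function `σ ↦ σ a` on the spectrum. -/
def eval (hu : IsStrongUnit u) (a : R) : Loc (Spectrum u) where
  preimage :=
    { toFun := fun V => ⨆ (p : ℝ) (q : ℝ) (_ : Set.Ioo p q ⊆ V), between u a p q
      map_inf' := by
        intro V W
        apply le_antisymm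
        · refine iSup_le fun p => iSup₂_le fun q h => le_inf ?_ ?_
          · exact le_iSup_of_le p (le_iSup₂_of_le q (fun x hx => (h hx).1) le_rfl)
          · exact le_iSup_of_le p (le_iSup₂_of_le q (fun x hx => (h hx).2) le_rfl)
        · simp only [iSup_inf_eq, inf_iSup_eq]
          refine iSup_le fun p => iSup_le fun q => iSup_le fun h => ?_
          refine iSup_le fun p' => iSup_le fun q' => iSup_le fun h' => ?_
          refine le_iSup_of_le (max p p') (le_iSup₂_of_le (min q q') ?_ ?_)
          · intro x hx
            rw [← Set.Ioo_inter_Ioo] at hx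
            exact ⟨h' hx.2, h hx.1⟩
          · rw [between_eq, between_eq, between_eq]
            refine (inf_comm _ _).trans_le (le_inf ?_ ?_)
            · rcases le_total p p' with hp | hp
              · rw [max_eq_right hp]
                exact inf_le_right.trans inf_le_left
              · rw [max_eq_left hp]
                exact inf_le_left.trans inf_le_left
            · rcases le_total q q' with hq | hq
              · rw [min_eq_left hq]
                exact inf_le_left.trans inf_le_right
              · rw [min_eq_right hq]
                exact inf_le_right.trans inf_le_right
      map_top' := by
        obtain ⟨n, h₁, h₂⟩ := exists_D_eq_top hu a
        refine top_unique (le_iSup_of_le (-n) (le_iSup₂_of_le n (fun _ _ => trivial) ?_))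
        rw [between_eq, h₁, h₂ n le_rfl, inf_top_eq]
      map_sSup' := by
        intro s
        apply le_antisymm
        · refine iSup_le fun p => iSup₂_le fun q h => between_le_of_Ioo_subset hu.nonneg a ?_ h
          intro U hU p' q' h'
          rw [sSup_image]
          exact le_iSup₂_of_le U hU (le_iSup_of_le p' (le_iSup₂_of_le q' h' le_rfl))
        · refine sSup_le ?_
          rintro _ ⟨U, hU, rfl⟩
          refine iSup_le fun p => iSup₂_le fun q h => ?_
          exact le_iSup_of_le p (le_iSup₂_of_le q
            (fun x hx => Opens.mem_sSup.2 ⟨U, hU, h hx⟩) le_rfl) }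

section Eval

open Loc

variable (hu : IsStrongUnit u)

theorem eval_preimage (a : R) (V : Opens ℝ) :
    (eval hu a).preimage V = ⨆ (p : ℝ) (q : ℝ) (_ : Set.Ioo p q ⊆ V), between u a p q := rfl

theorem eval_preimage_Ioo (a : R) (p q : ℝ) :
    (eval hu a).preimage ⟨Set.Ioo p q, isOpen_Ioo⟩ = between u a p q := by
  rw [eval_preimage]
  refine le_antisymm (iSup_le fun p' => iSup₂_le fun q' h => between_le_between hu.nonneg a h) ?_
  exact le_iSup_of_le p (le_iSup₂_of_le q (Set.Subset.refl _) le_rfl)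

theorem eval_preimage_above (a : R) (r : ℝ) :
    (eval hu a).preimage (above r) = D u (a - r • u) := by
  rw [eval_preimage]
  apply le_antisymm
  · refine iSup_le fun p => iSup₂_le fun q h => ?_
    rcases le_or_gt q p with hqp | hpq
    · simp [between_eq_bot hu.nonneg a hqp]
    -- Points of (p, q) arbitrarily close to p all exceed r; the midpoint keeps the chosen point
    -- below q.
    · have hrp : r ≤ p := le_of_forall_gt_imp_ge_of_dense fun x hx => by
        have : min x ((p + q) / 2) ∈ Set.Ioo p q :=
          ⟨lt_min hx (by linarith), min_lt_of_right_lt (by linarith)⟩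
        exact (h this).le.trans (min_le_left _ _)
      rw [between_eq]
      exact inf_le_left.trans (D_sub_smul_anti hu.nonneg a hrp)
  · obtain ⟨n, -, hn⟩ := exists_D_eq_top hu a
    refine le_iSup_of_le r (le_iSup₂_of_le n (fun x hx => hx.1) ?_)
    rw [between_eq, hn n le_rfl, inf_top_eq]

theorem eval_preimage_below (a : R) (r : ℝ) :
    (eval hu a).preimage (below r) = D u (r • u - a) := by
  rw [eval_preimage]
  apply le_antisymm
  · refine iSup_le fun p => iSup₂_le fun q h => ?_
    rcases le_or_gt q p with hqp | hpq
    · simp [between_eq_bot hu.nonneg a hqp]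
    · have hrp : q ≤ r := le_of_forall_lt_imp_le_of_dense fun x hx => by
        have : max x ((p + q) / 2) ∈ Set.Ioo p q :=
          ⟨lt_max_of_lt_right (by linarith), max_lt hx (by linarith)⟩
        exact (le_max_left _ _).trans (h this).le
      rw [between_eq]
      exact inf_le_right.trans (D_smul_sub_mono hu.nonneg a hrp)
  · obtain ⟨n, hn, -⟩ := exists_D_eq_top hu a
    refine le_iSup_of_le (-n) (le_iSup₂_of_le r (fun x hx => hx.2) ?_)
    rw [between_eq, hn, top_inf_eq]

/-! ### Evaluation is a Riesz morphism. -/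

variable {hu}

/-- One-sided bounds suffice: D (a - r·u) and D (r·u - a) are disjoint, so `le_iff` yields both
inequalities. -/
theorem eval_eq {a : R} {f : Loc (Spectrum u)}
    (h₁ : ∀ r, f.preimage (above r) ≤ D u (a - r • u))
    (h₂ : ∀ r, f.preimage (below r) ≤ D u (r • u - a)) : eval hu a = f := by
  have hD : ∀ r : ℝ, D u (a - r • u) ⊓ D u (r • u - a) = ⊥ := fun r => by
    rw [← neg_sub a, D_inf_D_neg]
  refine le_antisymm (le_iff.2 fun r => bot_unique ?_) (le_iff.2 fun r => bot_unique ?_)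
  · rw [eval_preimage_above, ← hD r]
    exact inf_le_inf_left _ (h₂ r)
  · rw [eval_preimage_below, ← hD r]
    exact inf_le_inf_right _ (h₁ r)

theorem eval_smul_unit (c : ℝ) : eval hu (c • u) = const _ c := by
  refine eval_eq (fun r => ?_) (fun r => ?_)
  · by_cases h : c ∈ above r
    · rw [← sub_smul, D_smul_unit (sub_pos.2 h)]
      exact le_top
    · rw [const_preimage_of_notMem h]
      exact bot_le
  · by_cases h : c ∈ below r
    · rw [← sub_smul, D_smul_unit (sub_pos.2 h)]
      exact le_top
    · rw [const_preimage_of_notMem h]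
      exact bot_le

theorem eval_unit : eval hu u = const _ 1 := by
  rw [← eval_smul_unit (hu := hu), one_smul]

theorem eval_add (a b : R) : eval hu (a + b) = eval hu a + eval hu b := by
  refine eval_eq (fun r => ?_) (fun r => ?_)
  · refine (add_preimage_above_le _ _ r).trans (iSup_le fun p => ?_)
    rw [eval_preimage_above, eval_preimage_above,
      show a + b - r • u = a - p • u + (b - (r - p) • u) by module]
    exact D_inf_le_D_add _ _
  · refine (add_preimage_below_le _ _ r).trans (iSup_le fun p => ?_)
    rw [eval_preimage_below, eval_preimage_below,
      show r • u - (a + b) = p • u - a + ((r - p) • u - b) by module]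
    exact D_inf_le_D_add _ _

theorem eval_neg (a : R) : eval hu (-a) = -eval hu a := by
  refine eval_eq (fun r => ?_) (fun r => ?_)
  · rw [neg_preimage_above, eval_preimage_below, show -a - r • u = -r • u - a by module]
  · rw [neg_preimage_below, eval_preimage_above, show r • u - -a = a - -r • u by module]

theorem eval_smul_of_pos {c : ℝ} (hc : 0 < c) (a : R) : eval hu (c • a) = c • eval hu a := by
  refine eval_eq (fun r => ?_) (fun r => ?_)
  · rw [smul_preimage_above_of_pos hc, eval_preimage_above, ← D_smul hc, smul_sub, smul_smul,
      mul_inv_cancel_left₀ hc.ne']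
  · rw [smul_preimage_below_of_pos hc, eval_preimage_below, ← D_smul hc, smul_sub, smul_smul,
      mul_inv_cancel_left₀ hc.ne']

theorem eval_smul (c : ℝ) (a : R) : eval hu (c • a) = c • eval hu a := by
  rcases lt_trichotomy c 0 with hc | rfl | hc
  · have := eval_smul_of_pos (hu := hu) (neg_pos.2 hc) a
    rwa [neg_smul, neg_smul, eval_neg, neg_inj] at this
  · rw [zero_smul, zero_smul, ← zero_smul ℝ u, eval_smul_unit]
    rfl
  · exact eval_smul_of_pos hc a

theorem eval_sup (a b : R) : eval hu (a ⊔ b) = eval hu a ⊔ eval hu b := by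
  refine eval_eq (fun r => ?_) (fun r => ?_)
  · refine (sup_preimage_above_le _ _ r).trans_eq ?_
    rw [eval_preimage_above, eval_preimage_above, ← D_sup, ← sup_sub]
  · refine (sup_preimage_below_le _ _ r).trans_eq ?_
    rw [eval_preimage_below, eval_preimage_below, ← D_inf, sub_sup]

variable (hu) in
/-- The representation of `R` by continuous functions on its spectrum. -/
def evalLinear : R →ₗ[ℝ] Loc (Spectrum u) where
  toFun := eval hu
  map_add' := eval_add
  map_smul' := eval_smul

theorem evalLinear_apply (a : R) : evalLinear hu a = eval hu a := rfl

theorem eval_inf (a b : R) : eval hu (a ⊓ b) = eval hu a ⊓ eval hu b := by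
  rw [eq_sub_of_add_eq (inf_add_sup a b), eq_sub_of_add_eq (inf_add_sup (eval hu a) (eval hu b)),
    ← eval_sup, ← evalLinear_apply, map_sub, map_add]
  rfl

theorem eval_mono {a b : R} (h : a ≤ b) : eval hu a ≤ eval hu b := by
  rw [← sup_eq_right] at h ⊢
  rw [← eval_sup, h]

theorem abs_eval (a : R) : |eval hu a| = eval hu |a| := by
  rw [abs, abs, eval_sup, eval_neg]

theorem eval_zero : eval hu 0 = 0 := map_zero (evalLinear hu)

/-! ### Norm, boundedness and density. -/

theorem le_smul_of_eval_le {a : R} {q : ℝ} (h : eval hu a ≤ const _ q) {s : ℝ} (hs : 0 < s) :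
    a ≤ (q + s) • u := by
  have h' := preimage_above_mono h q
  rw [eval_preimage_above, const_preimage_of_notMem (by simp [above]), le_bot_iff] at h'
  have := le_smul_of_D_eq_bot hu h' hs
  rwa [sub_le_iff_le_add', ← add_smul] at this

theorem unitNorm_le {A : Type*} [AddCommGroup A] [Lattice A] [Module ℝ A] {e a : A} {q : ℝ}
    (hq : 0 ≤ q) (h : |a| ≤ q • e) : unitNorm e a ≤ q :=
  csInf_le ⟨0, fun _ hx => hx.1⟩ ⟨hq, h⟩

theorem unitNorm_eval (a : R) : unitNorm (const _ 1) (eval hu a) = unitNorm u a := by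
  obtain ⟨n, hn⟩ := hu.exists_abs_le a
  have hsub : ∀ q : ℝ, |a| ≤ q • u → |eval hu a| ≤ q • const _ 1 := fun q hq => by
    rw [abs_eval, smul_const_one, ← eval_smul_unit (hu := hu)]
    exact eval_mono hq
  apply le_antisymm
  · exact le_csInf ⟨n, n.cast_nonneg, hn⟩ fun q hq => unitNorm_le hq.1 (hsub q hq.2)
  · refine le_csInf ⟨n, n.cast_nonneg, hsub n hn⟩ fun q hq => ?_
    -- Since R may have infinitesimals, the order is recovered only up to s·u; the infimum absorbs
    -- this loss.
    refine le_of_forall_pos_le_add fun s hs => unitNorm_le (add_nonneg hq.1 hs.le) ?_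
    refine le_smul_of_eval_le (hu := hu) ?_ hs
    rw [← abs_eval, ← smul_const_one]
    exact hq.2

/-- The inverse images of (-n, n) increase to ⊤, so by compactness one of them is ⊤. -/
theorem exists_abs_le_const (hu : IsStrongUnit u) (f : Loc (Spectrum u)) :
    ∃ n : ℕ, const _ (-(n : ℝ)) ≤ f ∧ f ≤ const _ (n : ℝ) := by
  have hmono : Monotone fun n : ℕ =>
      f.preimage ⟨Set.Ioo (-(n : ℝ)) n, isOpen_Ioo⟩ := fun n m hnm => by
    have hnm' : (n : ℝ) ≤ m := by exact_mod_cast hnm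
    exact OrderHomClass.mono f.preimage (Set.Ioo_subset_Ioo (neg_le_neg hnm') hnm')
  obtain ⟨n, hn⟩ := exists_eq_top_of_iSup_eq_top hu hmono (by
    rw [← map_iSup, ← map_top f.preimage]
    congr 1
    refine top_unique fun x _ => ?_
    obtain ⟨n, hn⟩ := exists_nat_gt |x|
    exact Opens.mem_iSup.2 ⟨n, abs_lt.1 hn⟩)
  refine ⟨n, ?_⟩
  obtain ⟨F, a, -, -, rfl, -, -⟩ := exists_pull f f f
  rw [const_eq_pull F, const_eq_pull F, pull_le_pull_iff, pull_le_pull_iff]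
  rw [pull_preimage] at hn
  constructor <;> rw [← inf_top_eq (F _), ← hn, ← map_inf, ← map_bot F] <;> congr 1 <;>
    refine bot_unique fun x hx => ?_
  · exact lt_asymm (show a x < -(n : ℝ) from hx.1) hx.2.1
  · exact lt_asymm (show (n : ℝ) < a x from hx.1) hx.2.2

theorem isStrongUnit_const_one (hu : IsStrongUnit u) : IsStrongUnit (const (Spectrum u) 1) := by
  intro f
  obtain ⟨n, h₁, h₂⟩ := exists_abs_le_const hu f
  refine ⟨n, ?_⟩
  rw [← Nat.cast_smul_eq_nsmul ℝ, smul_const_one]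
  exact abs_le_const h₁ h₂

/-- The Tietze step. A Urysohn element b for the cover f > -M/3, f < M/3 is rescaled to a with
values in [-M/3, M/3], equal to -M/3 where f < -M/3 and to M/3 where f > M/3. -/
theorem exists_sub_eval_le (f : Loc (Spectrum u)) {M : ℝ} (hM : 0 < M)
    (h₁ : const _ (-M) ≤ f) (h₂ : f ≤ const _ M) :
    ∃ a : R, const _ (-(M * (2 / 3))) ≤ f - eval hu a ∧ f - eval hu a ≤ const _ (M * (2 / 3)) := by
  have hcov : f.preimage (above (-(M / 3))) ⊔ f.preimage (below (M / 3)) = ⊤ := by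
    rw [← map_sup, ← map_top f.preimage]
    congr 1
    refine top_unique fun x _ => ?_
    rcases lt_or_ge x (M / 3) with hx | hx
    · exact Or.inr hx
    · exact Or.inl (show -(M / 3) < x by linarith)
  obtain ⟨b, hb₀, hb₁, hV, hW⟩ := exists_D_le_of_sup_eq_top hu hcov
  refine ⟨(2 * M / 3) • b - (M / 3) • u, ?_⟩
  have hg₀ : eval hu 0 ≤ eval hu b := eval_mono hb₀
  have hg₁ : eval hu b ≤ eval hu u := eval_mono hb₁
  have hg₂ : (eval hu b).preimage (above 0) ⊓ f.preimage (below (-(M / 3))) = ⊥ := by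
    rw [eval_preimage_above, zero_smul, sub_zero, eq_bot_iff, ← above_inf_below f]
    exact inf_le_inf_right _ hV
  have hg₃ : (eval hu b).preimage (below 1) ⊓ f.preimage (above (M / 3)) = ⊥ := by
    rw [eval_preimage_below, one_smul, inf_comm, eq_bot_iff, ← above_inf_below f]
    exact inf_le_inf_left _ hW
  rw [← evalLinear_apply, map_sub, map_smul, map_smul, evalLinear_apply, evalLinear_apply]
  rw [eval_unit] at *
  rw [eval_zero] at hg₀
  generalize eval hu b = g at *
  obtain ⟨F, x, y, -, rfl, rfl, -⟩ := exists_pull f g g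
  rw [const_eq_pull F, pull_le_pull_iff] at h₁ h₂ hg₁
  rw [← pull_zero F, pull_le_pull_iff] at hg₀
  simp only [pull_preimage, ← map_inf] at hg₂ hg₃
  simp only [const_eq_pull F, ← pull_smul, ← pull_sub, pull_le_pull_iff]
  -- A point with no neighbourhood killed by F satisfies every hypothesis pointwise, so real
  -- arithmetic at that point rules it out.
  constructor <;> refine bot_unique (le_of_forall_mem_exists F _ _ fun p hp => ?_) <;>
    by_contra! h
  all_goals
    have k₁ : -M ≤ x p := not_lt.1 fun hlt => h _ hlt h₁.le
    have k₂ : x p ≤ M := not_lt.1 fun hlt => h _ hlt h₂.le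
    have k₃ : 0 ≤ y p := not_lt.1 fun hlt => h _ hlt hg₀.le
    have k₄ : y p ≤ 1 := not_lt.1 fun hlt => h _ hlt hg₁.le
    have k₅ : ¬ (0 < y p ∧ x p < -(M / 3)) := fun hlt => h _ hlt hg₂.le
    have k₆ : ¬ (y p < 1 ∧ M / 3 < x p) := fun hlt => h _ hlt hg₃.le
  · have hp' : x p - (2 * M / 3 * y p - M / 3 * 1) < -(M * (2 / 3)) := hp
    rcases k₃.lt_or_eq with hy | hy
    · have := not_lt.1 fun hlt => k₅ ⟨hy, hlt⟩
      nlinarith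
    · rw [← hy] at hp'
      linarith
  · have hp' : M * (2 / 3) < x p - (2 * M / 3 * y p - M / 3 * 1) := hp
    rcases k₄.lt_or_eq with hy | hy
    · have := not_lt.1 fun hlt => k₆ ⟨hy, hlt⟩
      nlinarith
    · rw [hy] at hp'
      linarith

theorem exists_unitNorm_sub_eval_lt (hu : IsStrongUnit u) (f : Loc (Spectrum u)) {ε : ℝ}
    (hε : 0 < ε) : ∃ a : R, unitNorm (const _ 1) (f - eval hu a) < ε := by
  obtain ⟨n, hn₁, hn₂⟩ := exists_abs_le_const hu f
  -- Adding 1 keeps M positive even when n = 0.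
  set M : ℝ := n + 1 with hM
  have hM₀ : 0 < M := by positivity
  have const_mono : ∀ {r s : ℝ}, r ≤ s → const (Spectrum u) r ≤ const _ s := fun {r s} h => by
    rw [← eval_smul_unit (hu := hu), ← eval_smul_unit (hu := hu)]
    exact eval_mono (smul_le_smul_right_of_le h hu.nonneg)
  have key : ∀ k : ℕ, ∃ a : R, const _ (-(M * (2 / 3) ^ k)) ≤ f - eval hu a ∧
      f - eval hu a ≤ const _ (M * (2 / 3) ^ k) := by
    intro k
    induction k with
    | zero =>
      refine ⟨0, ?_⟩
      rw [eval_zero, sub_zero, pow_zero, mul_one]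
      exact ⟨(const_mono (by linarith)).trans hn₁, hn₂.trans (const_mono (by linarith))⟩
    | succ k ih =>
      obtain ⟨a, h₁, h₂⟩ := ih
      obtain ⟨b, hb⟩ := exists_sub_eval_le (hu := hu) _ (by positivity) h₁ h₂
      refine ⟨a + b, ?_⟩
      rwa [eval_add, ← sub_sub, pow_succ, ← mul_assoc]
  obtain ⟨k, hk⟩ := exists_pow_lt_of_lt_one (div_pos hε hM₀) (by norm_num : (2 / 3 : ℝ) < 1)
  obtain ⟨a, h₁, h₂⟩ := key k
  refine ⟨a, (unitNorm_le (q := M * (2 / 3) ^ k) (by positivity) ?_).trans_lt ?_⟩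
  · rw [smul_const_one]
    exact abs_le_const h₁ h₂
  · rwa [lt_div_iff₀' hM₀] at hk

end Eval

end Spectrum

theorem mainTheorem6 {R : Type*} [AddCommGroup R] [Lattice R] [IsOrderedAddMonoid R]
    [Module ℝ R] [PosSMulMono ℝ R] (u : R) (hu : IsStrongUnit u) :
    ∃ inst : FAlgebra (Loc (Spectrum u)),
      Loc.IsPointwise inst ∧
      (∀ f : Loc (Spectrum u), Loc.const _ 1 * f = f ∧ f * Loc.const _ 1 = f) ∧
      IsStrongUnit (Loc.const (Spectrum u) 1) ∧
      ∃ φ : R →ₗ[ℝ] Loc (Spectrum u),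
        (∀ (a : R) (p q : ℝ), (φ a).preimage ⟨Set.Ioo p q, isOpen_Ioo⟩ =
          Spectrum.D u ((a - p • u) ⊓ (q • u - a))) ∧
        (∀ a b : R, φ (a ⊔ b) = φ a ⊔ φ b) ∧
        (∀ a b : R, φ (a ⊓ b) = φ a ⊓ φ b) ∧
        φ u = Loc.const _ 1 ∧
        (∀ a : R, unitNorm (Loc.const _ 1) (φ a) = unitNorm u a) ∧
        (∀ (f : Loc (Spectrum u)) (ε : ℝ), 0 < ε →
          ∃ a : R, unitNorm (Loc.const _ 1) (f - φ a) < ε) := by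
  exact ⟨Loc.instFAlgebra, Loc.isPointwise, fun f => ⟨Loc.const_one_mul f, Loc.mul_const_one f⟩,
    Spectrum.isStrongUnit_const_one hu, Spectrum.evalLinear hu, Spectrum.eval_preimage_Ioo hu,
    Spectrum.eval_sup (hu := hu), Spectrum.eval_inf (hu := hu), Spectrum.eval_unit (hu := hu),
    Spectrum.unitNorm_eval (hu := hu),
    fun f _ hε => Spectrum.exists_unitNorm_sub_eval_lt hu f hε⟩
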